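/- Let $G=G^{ss}\times(\mathbb C^*)^r$ be a connected complex reductive algebraic group with $G^{ss}$ semisimple and simply connected. Fix a Borel subgroup and a maximal torus contained in it, and let $\Phi^+$ be the set of positive roots, $N=|\Phi^+|$, $\Lambda^+$ the monoid of dominant integral weights of $G$, $\mathfrak n^-$ the Lie algebra spanned by the root vectors of negative weights, and $U^-$ the unipotent subgroup with Lie algebra $\mathfrak n^-$. For each $\beta\in\Phi^+$ fix a nonzero root vector $f_\beta\in\mathfrak n^-$ of weight $-\beta$. Let $S=(\beta_1,\dots,\beta_N)$ be a birational sequence, i.e. a sequence of positive roots, repetitions being allowed, such that the map $\mathbb C^N\to U^-$, $(z_1,\dots,z_N)\mapsto \exp(z_1f_{\beta_1})\cdots\exp(z_Nf_{\beta_N})$, is birational. Let $\Psi:\mathbb Z^N\to\mathbb Z$ be a $\mathbb Z$-linear map with $\Psi(\mathbb N^N)\subseteq\mathbb N$ (where $0\in\mathbb N$), and let $>$ be a $\Psi$-weighted lex order on $\mathbb N^N$. That is, $\mathbf m>\mathbf m'$ if and only if $\Psi(\mathbf m)>\Psi(\mathbf m')$, or $\Psi(\mathbf m)=\Psi(\mathbf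 m')$ and $\mathbf m$ is larger than $\mathbf m'$ in one fixed tie-breaking order, which is the lexicographic order, or the right lexicographic order, or, provided that $\Psi(\mathbf k)>0$ for all $\mathbf k\in\mathbb N^N\setminus\{0\}$, the opposite of one of these two orders. (In the right lexicographic order $\mathbf m$ is larger than $\mathbf m'$ if $m_i>m_i'$ for the largest index $i$ with $m_i\neq m_i'$.) For $\mathbf m\in\mathbb N^N$ put $\mathbf f^{(\mathbf m)}=\frac{f_{\beta_1}^{m_1}}{m_1!}\cdots\frac{f_{\beta_N}^{m_N}}{m_N!}\in\mathcal U(\mathfrak n^-)$, let $\mathcal U(\mathfrak n^-)_{\le\mathbf m}$ be the linear span of the $\mathbf f^{(\mathbf k)}$ with $\mathbf k\le\mathbf m$, and let $\mathcal U(\mathfrak n^-)_{<\mathbf m}$ be the linear span of those with $\mathbf k<\mathbf m$. Let $es(\mathfrak n^-)$ be the set of all $\mathbf m\in\mathbb N^N$ with $\mathcal U(\mathfrak n^-)_{\le\mathbf m}/\mathcal U(\mathfrak n^-)_{<\mathbf m}\neq0$. For $\lambda\in\Lambda^+$ let $V(\lambda)$ be the irreducible representation of $G$ of highest weight $\lambda$,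 with a highest weight vector $v_\lambda$. The pair $(\lambda,\mathbf m)$ is called essential for $V(\lambda)$ if $\mathcal U(\mathfrak n^-)_{\le\mathbf m}v_\lambda/\mathcal U(\mathfrak n^-)_{<\mathbf m}v_\lambda\neq0$, and $es(\lambda)$ is the set of all $\mathbf m$ such that $(\lambda,\mathbf m)$ is essential for $V(\lambda)$. Then: (i) $es(\mathfrak n^-)$ is a submonoid of $\mathbb N^N$; in particular $\mathbf m,\mathbf m'\in es(\mathfrak n^-)$ implies $\mathbf m+\mathbf m'\in es(\mathfrak n^-)$. (ii) If $(\lambda,\mathbf m)$ is essential for $V(\lambda)$ and $(\mu,\mathbf m')$ is essential for $V(\mu)$, then $(\lambda+\mu,\mathbf m+\mathbf m')$ is essential for $V(\lambda+\mu)$. (iii) For every $\lambda\in\Lambda^+$ the set $\Gamma(\lambda)=\bigcup_{n\in\mathbb N}\{n\}\times es(n\lambda)$ is a submonoid of $\mathbb N\times\mathbb N^N$, and the set $\Gamma=\bigcup_{\lambda\in\Lambda^+}\{\lambda\}\times es(\lambda)$ is a submonoid of $\Lambda^+\times\mathbb N^N$. -/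

import Mathlib

/-! Setting.  `G = G^ss × (ℂ^*)^r` with `G^ss` simply connected semisimple.  It is given by the
semisimple Lie algebra `𝔤 = Lie G^ss`, a Cartan subalgebra `H`, a base `b` of the root system
of `(𝔤, H)` (the choice of a Borel subalgebra containing `H`) and the number `r`.  As `G^ss` is simply
connected, every integral weight of `H` is a weight of its maximal torus, and a rational
representation of `G` is a finite dimensional `𝔤`-module with a commuting rational action of the
torus `(ℂ^*)^r`. -/

open LieAlgebra LieAlgebra.IsKilling

noncomputable section

namespace EssentialMonoid

variable {𝔤 : Type*} [LieRing 𝔤] [LieAlgebra ℂ 𝔤] [FiniteDimensional ℂ 𝔤] [IsKilling ℂ 𝔤]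
  {H : LieSubalgebra ℂ 𝔤} [H.IsCartanSubalgebra]

/-! ### Roots, the nilpotent subalgebra and dominant weights -/

/-- The set `Φ⁺` of positive roots. -/
abbrev PosRoot (b : (rootSystem H).Base) : Type _ := {α : H.root // b.IsPos α}

/-- The number `N` of positive roots. -/
def numPos (b : (rootSystem H).Base) : ℕ := Nat.card (PosRoot b)

/-- The root space `𝔤_β`, for a positive root `β`. -/
def posSpace (b : (rootSystem H).Base) (β : PosRoot b) : Submodule ℂ 𝔤 :=
  (rootSpace H (β.1.1 : H → ℂ)).toSubmodule

/-- The root space `𝔤_{-β}`, for a positive root `β`. -/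
def negSpace (b : (rootSystem H).Base) (β : PosRoot b) : Submodule ℂ 𝔤 :=
  (rootSpace H (-(β.1.1 : H → ℂ))).toSubmodule

/-- The Lie subalgebra `𝔫⁻`, generated (equivalently, spanned) by the root spaces `𝔤_{-β}`,
`β ∈ Φ⁺`. -/
def nMinus (b : (rootSystem H).Base) : LieSubalgebra ℂ 𝔤 :=
  LieSubalgebra.lieSpan ℂ 𝔤 {x | ∃ β : PosRoot b, x ∈ negSpace b β}

/-- The enveloping algebra `U(𝔫⁻)`. -/
abbrev Un (b : (rootSystem H).Base) : Type _ := UniversalEnvelopingAlgebra ℂ (nMinus b)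

/-- The monoid `Λ⁺` of dominant integral weights of `G = G^ss × (ℂ^*)^r`: pairs of a weight of `H`
whose values on the positive coroots are natural numbers, and of a character of `(ℂ^*)^r`, i.e. an
element of `ℤ^r`. -/
def dominantWeights (b : (rootSystem H).Base) (r : ℕ) :
    AddSubmonoid (Module.Dual ℂ H × (Fin r → ℤ)) where
  carrier := {p | ∀ β : PosRoot b, ∃ n : ℕ, p.1 ((rootSystem H).coroot β.1) = n}
  zero_mem' := fun _ => ⟨0, by simp⟩
  add_mem' := by
    intro p q hp hq β
    obtain ⟨n, hn⟩ := hp β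
    obtain ⟨k, hk⟩ := hq β
    exact ⟨n + k, by simp only [Prod.fst_add, LinearMap.add_apply, hn, hk, Nat.cast_add]⟩

/-! ### The group `U⁻` and birational sequences

`U⁻ ⊂ G` meets the kernel of the adjoint representation trivially, so it is isomorphic, as an
algebraic group, to its image in `GL(𝔤)`, which is the group generated by the root subgroups
`{exp(ad x) | x ∈ 𝔤_{-β}}`.  This image is a Zariski closed subvariety of `End(𝔤)`. -/

/-- The exponential of a nilpotent endomorphism. -/
def nilExp (a : Module.End ℂ 𝔤) : Module.End ℂ 𝔤 :=
  ∑ k ∈ Finset.range (nilpotencyClass a), ((k.factorial : ℂ)⁻¹) • a ^ k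

/-- The group `U⁻` in its adjoint realisation (the generating set is stable under inversion, so that
the submonoid which it generates is a group). -/
def UMinus (b : (rootSystem H).Base) : Submonoid (Module.End ℂ 𝔤) :=
  Submonoid.closure {u | ∃ β : PosRoot b, ∃ x ∈ negSpace b β, u = nilExp (ad ℂ 𝔤 x)}

/-- The algebra of regular functions on `U⁻`: polynomials in the matrix coefficients. -/
def regularFunctions (b : (rootSystem H).Base) : Subalgebra ℂ (UMinus b → ℂ) :=
  Algebra.adjoin ℂ
    {F | ∃ (φ : Module.Dual ℂ 𝔤) (w : 𝔤), F = fun u : UMinus b => φ ((u : Module.End ℂ 𝔤) w)}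

/-- The family `f` consists of a nonzero root vector `f_β` of weight `-β` for each `β ∈ Φ⁺`. -/
def IsRootVectors (b : (rootSystem H).Base) (f : PosRoot b → nMinus b) : Prop :=
  ∀ β, (f β : 𝔤) ∈ negSpace b β ∧ f β ≠ 0

lemma nilExp_smul_mem {b : (rootSystem H).Base} {f : PosRoot b → nMinus b}
    (hf : IsRootVectors b f) (β : PosRoot b) (c : ℂ) :
    nilExp (ad ℂ 𝔤 (c • (f β : 𝔤))) ∈ UMinus b :=
  Submonoid.subset_closure ⟨β, _, (negSpace b β).smul_mem c (hf β).1, rfl⟩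

/-- The product map `π : ℂ^N → U⁻`, `z ↦ exp(z₁ f_{β₁}) ⋯ exp(z_N f_{β_N})`. -/
def productMap {b : (rootSystem H).Base} {f : PosRoot b → nMinus b} (hf : IsRootVectors b f)
    {N : ℕ} (S : Fin N → PosRoot b) (z : Fin N → ℂ) : UMinus b :=
  (List.ofFn fun i =>
    (⟨nilExp (ad ℂ 𝔤 (z i • (f (S i) : 𝔤))), nilExp_smul_mem hf (S i) (z i)⟩ : UMinus b)).prod

/-- `S` is a birational sequence: `π` is dominant, i.e. the pull back of regular functions along
`π` is injective, and the induced embedding `ℂ(U⁻) → ℂ(x₁, …, x_N)` of function fields is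
onto, i.e. every coordinate `x_i` is the pull back of a quotient of regular functions on `U⁻`. -/
def IsBirational {b : (rootSystem H).Base} {f : PosRoot b → nMinus b} (hf : IsRootVectors b f)
    {N : ℕ} (S : Fin N → PosRoot b) : Prop :=
  (∀ F ∈ regularFunctions b, (∀ z, F (productMap hf S z) = 0) → F = 0) ∧
  ∀ i, ∃ F₁ ∈ regularFunctions b, ∃ F₂ ∈ regularFunctions b,
    F₂ ≠ 0 ∧ ∀ z, z i * F₂ (productMap hf S z) = F₁ (productMap hf S z)

/-! ### Weighted lex orders on `ℕ^N` -/

/-- `m <_lex m'`. -/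
def LexLT {N : ℕ} (m m' : Fin N → ℕ) : Prop := ∃ i, (∀ j, j < i → m j = m' j) ∧ m i < m' i

/-- `m <_rlex m'`. -/
def RLexLT {N : ℕ} (m m' : Fin N → ℕ) : Prop := ∃ i, (∀ j, i < j → m j = m' j) ∧ m i < m' i

/-- The value of `Ψ : ℤ^N → ℤ` on an element of `ℕ^N`. -/
def wt {N : ℕ} (Ψ : (Fin N → ℤ) →ₗ[ℤ] ℤ) (m : Fin N → ℕ) : ℤ := Ψ fun i => (m i : ℤ)

/-- The relation: `Ψ(m) < Ψ(m')`, or `Ψ(m) = Ψ(m')` and `m` precedes `m'` for `tie`. -/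
def weightedLT {N : ℕ} (Ψ : (Fin N → ℤ) →ₗ[ℤ] ℤ) (tie : (Fin N → ℕ) → (Fin N → ℕ) → Prop)
    (m m' : Fin N → ℕ) : Prop :=
  wt Ψ m < wt Ψ m' ∨ (wt Ψ m = wt Ψ m' ∧ tie m m')

/-- `lt` is the strict relation `<` of one of the four kinds of `Ψ`-weighted lex orders, for some
integral weight function `Ψ`. -/
inductive IsWeightedLexOrder {N : ℕ} : ((Fin N → ℕ) → (Fin N → ℕ) → Prop) → Prop
  | lex (Ψ : (Fin N → ℤ) →ₗ[ℤ] ℤ) (hΨ : ∀ m, 0 ≤ wt Ψ m) :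
      IsWeightedLexOrder (weightedLT Ψ LexLT)
  | rlex (Ψ : (Fin N → ℤ) →ₗ[ℤ] ℤ) (hΨ : ∀ m, 0 ≤ wt Ψ m) :
      IsWeightedLexOrder (weightedLT Ψ RLexLT)
  | oppLex (Ψ : (Fin N → ℤ) →ₗ[ℤ] ℤ) (hΨ : ∀ m, 0 ≤ wt Ψ m) (hpos : ∀ m, m ≠ 0 → 0 < wt Ψ m) :
      IsWeightedLexOrder (weightedLT Ψ fun m m' => LexLT m' m)
  | oppRLex (Ψ : (Fin N → ℤ) →ₗ[ℤ] ℤ) (hΨ : ∀ m, 0 ≤ wt Ψ m) (hpos : ∀ m, m ≠ 0 → 0 < wt Ψ m) :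
      IsWeightedLexOrder (weightedLT Ψ fun m m' => RLexLT m' m)

/-! ### The filtration of `U(𝔫⁻)`

Here `x i` stands for `f_{β_i}`. -/

/-- The ordered product of divided powers `f^{(m)} = f_{β₁}^{(m₁)} ⋯ f_{β_N}^{(m_N)}`. -/
def divMonomial {b : (rootSystem H).Base} {N : ℕ} (x : Fin N → nMinus b) (m : Fin N → ℕ) : Un b :=
  (List.ofFn fun i =>
    (((m i).factorial : ℂ)⁻¹) • UniversalEnvelopingAlgebra.ι ℂ (x i) ^ m i).prod

/-- `U(𝔫⁻)_{≤ m}`. -/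
def Ule {b : (rootSystem H).Base} {N : ℕ} (x : Fin N → nMinus b)
    (lt : (Fin N → ℕ) → (Fin N → ℕ) → Prop) (m : Fin N → ℕ) : Submodule ℂ (Un b) :=
  Submodule.span ℂ {u | ∃ k, (lt k m ∨ k = m) ∧ u = divMonomial x k}

/-- `U(𝔫⁻)_{< m}`. -/
def Ult {b : (rootSystem H).Base} {N : ℕ} (x : Fin N → nMinus b)
    (lt : (Fin N → ℕ) → (Fin N → ℕ) → Prop) (m : Fin N → ℕ) : Submodule ℂ (Un b) :=
  Submodule.span ℂ {u | ∃ k, lt k m ∧ u = divMonomial x k}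

/-- The set `es(𝔫⁻)` of essential multi-exponents: the graded piece
`U(𝔫⁻)_{≤ m} / U(𝔫⁻)_{< m}` is not zero. -/
def esU {b : (rootSystem H).Base} {N : ℕ} (x : Fin N → nMinus b)
    (lt : (Fin N → ℕ) → (Fin N → ℕ) → Prop) : Set (Fin N → ℕ) :=
  {m | Nontrivial (Ule x lt m ⧸ (Ult x lt m).submoduleOf (Ule x lt m))}

/-! ### Irreducible representations of `G` and their induced filtrations -/

/-- An irreducible representation `V(lam)` of `G = G^ss × (ℂ^*)^r` of highest weight `lam`, together
with a highest weight vector `vec`.  (Irreducibility forces the commuting action of `(ℂ^*)^r` to be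
by the character which appears in `vec_torus`, so that it is rational.) -/
structure Irrep (b : (rootSystem H).Base) (r : ℕ) (lam : dominantWeights b r) where
  /-- the underlying vector space -/
  V : Type*
  [addCommGroup : AddCommGroup V]
  [module : Module ℂ V]
  [lieRingModule : LieRingModule 𝔤 V]
  [lieModule : LieModule ℂ 𝔤 V]
  finiteDimensional : FiniteDimensional ℂ V
  /-- the action of `(ℂ^*)^r` -/
  torus : Representation ℂ (Fin r → ℂˣ) V
  torus_lie : ∀ (t : Fin r → ℂˣ) (x : 𝔤) (w : V), torus t ⁅x, w⁆ = ⁅x, torus t w⁆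
  irreducible : ∀ W : LieSubmodule ℂ 𝔤 V, (∀ t, ∀ w ∈ W, torus t w ∈ W) → W = ⊥ ∨ W = ⊤
  /-- the highest weight vector -/
  vec : V
  vec_ne_zero : vec ≠ 0
  vec_pos : ∀ β : PosRoot b, ∀ x ∈ posSpace b β, ⁅x, vec⁆ = 0
  vec_weight : ∀ h : H, ⁅(h : 𝔤), vec⁆ = lam.1.1 h • vec
  vec_torus : ∀ t : Fin r → ℂˣ, torus t vec = (∏ i, (t i : ℂ) ^ lam.1.2 i) • vec

attribute [instance] Irrep.addCommGroup Irrep.module Irrep.lieRingModule Irrep.lieModule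

section

attribute [local instance] LieRing.ofAssociativeRing

/-- The orbit map `U(𝔫⁻) → V(lam)`, `u ↦ u v_lam`. -/
def Irrep.orbitMap {b : (rootSystem H).Base} {r : ℕ} {lam : dominantWeights b r}
    (M : Irrep b r lam) : Un b →ₗ[ℂ] M.V :=
  (LinearMap.applyₗ M.vec) ∘ₗ
    (UniversalEnvelopingAlgebra.lift ℂ
      ((LieModule.toEnd ℂ 𝔤 M.V).comp (nMinus b).incl)).toLinearMap

end

/-- The pair `(lam, m)` is essential for `V(lam)`: the graded piece `V(lam)_{≤ m} / V(lam)_{< m}` is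
not zero, where `V(lam)_{≤ m} = U(𝔫⁻)_{≤ m} v_lam` and `V(lam)_{< m} = U(𝔫⁻)_{< m} v_lam`. -/
def Irrep.IsEssential {b : (rootSystem H).Base} {r : ℕ} {lam : dominantWeights b r}
    (M : Irrep b r lam) {N : ℕ} (x : Fin N → nMinus b)
    (lt : (Fin N → ℕ) → (Fin N → ℕ) → Prop) (m : Fin N → ℕ) : Prop :=
  Nontrivial ((Ule x lt m).map M.orbitMap ⧸
    ((Ult x lt m).map M.orbitMap).submoduleOf ((Ule x lt m).map M.orbitMap))

/-- The set `es(lam)` of essential multi-exponents for `V(lam)`, which is unique up to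
isomorphism. -/
def es {b : (rootSystem H).Base} {r : ℕ} {N : ℕ} (x : Fin N → nMinus b)
    (lt : (Fin N → ℕ) → (Fin N → ℕ) → Prop) (lam : dominantWeights b r) : Set (Fin N → ℕ) :=
  {m | ∃ M : Irrep.{_, 0} b r lam, M.IsEssential x lt m}

/-- `Γ(lam) = ⋃_{n ∈ ℕ} {n} × es(n lam)`. -/
def gammaOf {b : (rootSystem H).Base} {r : ℕ} {N : ℕ} (x : Fin N → nMinus b)
    (lt : (Fin N → ℕ) → (Fin N → ℕ) → Prop) (lam : dominantWeights b r) :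
    Set (ℕ × (Fin N → ℕ)) :=
  {p | p.2 ∈ es x lt (p.1 • lam)}

/-- The global set `Γ = ⋃_{lam ∈ Λ⁺} {lam} × es(lam)`. -/
def gamma {b : (rootSystem H).Base} (r : ℕ) {N : ℕ} (x : Fin N → nMinus b)
    (lt : (Fin N → ℕ) → (Fin N → ℕ) → Prop) :
    Set (dominantWeights b r × (Fin N → ℕ)) :=
  {p | p.2 ∈ es x lt p.1}

end EssentialMonoid

end

noncomputable section

namespace EssentialMonoid

open scoped TensorProduct

/-! ### Weighted lex orders -/

section Order

variable {N : ℕ}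

/-! The engine is the comultiplication `Δ` of `U(𝔫⁻)`. On divided powers it carries no coefficients:
`Δ f^{(k)}` is the sum of `f^{(p)} ⊗ f^{(q)}` over all `p + q = k` (`comul_divMonomial`). An
exponent `m` is essential for a linear map `F` exactly when some functional kills `F f^{(k)}` for
all `k < m` but not `F f^{(m)}`. Given such functionals for `m` and `m'`, evaluate their tensor
product on `Δ`. If `p + q ≤ m + m'`, then `p < m` or `q < m'`, unless `(p, q) = (m, m')`. Hence the
composite kills everything below `m + m'` and is nonzero at `m + m'` (`add_essential`). About the
order this uses only that it is total and additive; that `0` is least puts `0` in each set.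

With identity maps this gives the claim for `es(𝔫⁻)`. For representations, what annihilates
`v_{λ+μ}` must annihilate `v_λ ⊗ v_μ`. Both are highest weight vectors of weight `λ + μ`, so it
suffices that the annihilator of a nonzero one depends only on its weight
(`IsHighestWeightVector.actU_eq_zero`). That rests on `IsHighestWeightVector.mem_of_ne_bot`: in a
finite dimensional module generated by a highest weight vector, every nonzero submodule contains
that vector. Complete reducibility is not invoked. The Casimir operator acts on the whole module by
`(λ, λ + 2ρ)`, and no dominant weight strictly below `λ` yields this scalar.

The same theorem shows that `v_λ ⊗ v_μ` generates an irreducible representation, so `V(λ + μ)`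
exists once `V(λ)` and `V(μ)` do. -/

lemma LexLT.irrefl (a : Fin N → ℕ) : ¬ LexLT a a := fun ⟨_, _, h⟩ => lt_irrefl _ h

lemma LexLT.trans {a b c : Fin N → ℕ} : LexLT a b → LexLT b c → LexLT a c := by
  rintro ⟨i, hi, hi'⟩ ⟨j, hj, hj'⟩
  rcases lt_trichotomy i j with h | rfl | h
  · exact ⟨i, fun k hk => (hi k hk).trans (hj k (hk.trans h)), (hj i h) ▸ hi'⟩
  · exact ⟨i, fun k hk => (hi k hk).trans (hj k hk), hi'.trans hj'⟩
  · exact ⟨j, fun k hk => (hi k (hk.trans h)).trans (hj k hk), (hi j h).symm ▸ hj'⟩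

lemma LexLT.trichotomy (a b : Fin N → ℕ) : LexLT a b ∨ a = b ∨ LexLT b a := by
  by_cases h : a = b
  · exact Or.inr (Or.inl h)
  have hne : (Finset.univ.filter fun i => a i ≠ b i).Nonempty := by
    obtain ⟨i, hi⟩ := Function.ne_iff.mp h
    exact ⟨i, by simpa using hi⟩
  have hmin : ∀ j, j < Finset.min' _ hne → a j = b j := fun j hj => by
    by_contra hc
    exact absurd (Finset.min'_le _ j (by simpa using hc)) (not_le.mpr hj)
  have hmem := Finset.min'_mem _ hne
  simp only [Finset.mem_filter, Finset.mem_univ, true_and] at hmem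
  rcases lt_or_gt_of_ne hmem with hl | hl
  · exact Or.inl ⟨_, hmin, hl⟩
  · exact Or.inr (Or.inr ⟨_, fun j hj => (hmin j hj).symm, hl⟩)

lemma LexLT.add_right {a b : Fin N → ℕ} (h : LexLT a b) (c : Fin N → ℕ) :
    LexLT (a + c) (b + c) := by
  obtain ⟨i, hi, hi'⟩ := h
  exact ⟨i, fun j hj => by simp [hi j hj], by simpa using hi'⟩

lemma LexLT.not_zero (a : Fin N → ℕ) : ¬ LexLT a 0 := fun ⟨_, _, h⟩ => Nat.not_lt_zero _ h

lemma rlexLT_iff_lexLT_rev {a b : Fin N → ℕ} :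
    RLexLT a b ↔ LexLT (a ∘ Fin.rev) (b ∘ Fin.rev) := by
  constructor
  · rintro ⟨i, hi, hi'⟩
    exact ⟨i.rev, fun j hj => hi _ (Fin.lt_rev_iff.mp hj), by simpa using hi'⟩
  · rintro ⟨i, hi, hi'⟩
    refine ⟨i.rev, fun j hj => ?_, hi'⟩
    simpa using hi j.rev (Fin.rev_lt_iff.mp hj)

/-- A strict total order on `ℕ^N` which is compatible with addition and has `0` as its least
element. -/
structure IsMonomialOrder (lt : (Fin N → ℕ) → (Fin N → ℕ) → Prop) : Prop where
  irrefl : ∀ a, ¬ lt a a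
  trans : ∀ a b c, lt a b → lt b c → lt a c
  trichotomy : ∀ a b, lt a b ∨ a = b ∨ lt b a
  add_right : ∀ a b c, lt a b → lt (a + c) (b + c)
  not_zero : ∀ a, ¬ lt a 0

lemma wt_add (Ψ : (Fin N → ℤ) →ₗ[ℤ] ℤ) (a b : Fin N → ℕ) : wt Ψ (a + b) = wt Ψ a + wt Ψ b := by
  rw [wt, wt, wt, ← map_add]
  congr 1

lemma wt_zero (Ψ : (Fin N → ℤ) →ₗ[ℤ] ℤ) : wt Ψ (0 : Fin N → ℕ) = 0 := by
  have := wt_add Ψ 0 0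
  simpa using this

/-- Minimality of `0` is asked of the tie-break only among exponents of weight `0`. This admits the
opposite orders: when `Ψ` is positive away from `0`, the only such exponent is `0`. -/
lemma isMonomialOrder_weightedLT (Ψ : (Fin N → ℤ) →ₗ[ℤ] ℤ) (hΨ : ∀ m, 0 ≤ wt Ψ m)
    {tie : (Fin N → ℕ) → (Fin N → ℕ) → Prop} (irrefl : ∀ a, ¬ tie a a)
    (trans : ∀ a b c, tie a b → tie b c → tie a c)
    (trichotomy : ∀ a b, tie a b ∨ a = b ∨ tie b a)
    (add_right : ∀ a b c, tie a b → tie (a + c) (b + c))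
    (not_zero : ∀ a, wt Ψ a = 0 → ¬ tie a 0) :
    IsMonomialOrder (weightedLT Ψ tie) where
  irrefl a h := h.elim (lt_irrefl _) fun h => irrefl a h.2
  trans a b c := by
    rintro (h | ⟨h, h'⟩) (k | ⟨k, k'⟩)
    · exact Or.inl (h.trans k)
    · exact Or.inl (h.trans_eq k)
    · exact Or.inl (h.trans_lt k)
    · exact Or.inr ⟨h.trans k, trans _ _ _ h' k'⟩
  trichotomy a b := by
    rcases lt_trichotomy (wt Ψ a) (wt Ψ b) with h | h | h
    · exact Or.inl (Or.inl h)
    · rcases trichotomy a b with t | t | t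
      · exact Or.inl (Or.inr ⟨h, t⟩)
      · exact Or.inr (Or.inl t)
      · exact Or.inr (Or.inr (Or.inr ⟨h.symm, t⟩))
    · exact Or.inr (Or.inr (Or.inl h))
  add_right a b c := by
    rintro (h | ⟨h, h'⟩)
    · exact Or.inl (by simpa [wt_add] using h)
    · exact Or.inr ⟨by simpa [wt_add] using h, add_right _ _ _ h'⟩
  not_zero a := by
    rintro (h | ⟨h, h'⟩)
    · exact absurd (hΨ a) (not_le.mpr (by simpa [wt_zero] using h))
    · exact not_zero a (by simpa [wt_zero] using h) h'

lemma RLexLT.irrefl (a : Fin N → ℕ) : ¬ RLexLT a a := fun ⟨_, _, h⟩ => lt_irrefl _ h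

lemma RLexLT.trans {a b c : Fin N → ℕ} : RLexLT a b → RLexLT b c → RLexLT a c := by
  simpa only [rlexLT_iff_lexLT_rev] using LexLT.trans

lemma RLexLT.trichotomy (a b : Fin N → ℕ) : RLexLT a b ∨ a = b ∨ RLexLT b a := by
  simpa only [rlexLT_iff_lexLT_rev, Fin.rev_surjective.injective_comp_right.eq_iff]
    using LexLT.trichotomy (a ∘ Fin.rev) (b ∘ Fin.rev)

lemma RLexLT.add_right {a b : Fin N → ℕ} (h : RLexLT a b) (c : Fin N → ℕ) :
    RLexLT (a + c) (b + c) := by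
  obtain ⟨i, hi, hi'⟩ := h
  exact ⟨i, fun j hj => by simp [hi j hj], by simpa using hi'⟩

lemma RLexLT.not_zero (a : Fin N → ℕ) : ¬ RLexLT a 0 := fun ⟨_, _, h⟩ => Nat.not_lt_zero _ h

lemma IsWeightedLexOrder.isMonomialOrder {lt : (Fin N → ℕ) → (Fin N → ℕ) → Prop}
    (h : IsWeightedLexOrder lt) : IsMonomialOrder lt := by
  have eq_zero {Ψ : (Fin N → ℤ) →ₗ[ℤ] ℤ} (hpos : ∀ m, m ≠ 0 → 0 < wt Ψ m) {a : Fin N → ℕ}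
      (ha : wt Ψ a = 0) : a = 0 := by
    by_contra hc
    exact (hpos a hc).ne' ha
  cases h with
  | lex Ψ hΨ =>
    exact isMonomialOrder_weightedLT Ψ hΨ LexLT.irrefl (fun _ _ _ => LexLT.trans)
      LexLT.trichotomy (fun _ _ c h => h.add_right c) fun a _ => LexLT.not_zero a
  | rlex Ψ hΨ =>
    exact isMonomialOrder_weightedLT Ψ hΨ RLexLT.irrefl (fun _ _ _ => RLexLT.trans)
      RLexLT.trichotomy (fun _ _ c h => h.add_right c) fun a _ => RLexLT.not_zero a
  | oppLex Ψ hΨ hpos =>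
    exact isMonomialOrder_weightedLT Ψ hΨ LexLT.irrefl (fun _ _ _ h k => LexLT.trans k h)
      (fun a b => by simpa [eq_comm] using LexLT.trichotomy b a)
      (fun _ _ c h => h.add_right c) fun a ha => by
        rw [eq_zero hpos ha]
        exact LexLT.irrefl 0
  | oppRLex Ψ hΨ hpos =>
    exact isMonomialOrder_weightedLT Ψ hΨ RLexLT.irrefl (fun _ _ _ h k => RLexLT.trans k h)
      (fun a b => by simpa [eq_comm] using RLexLT.trichotomy b a)
      (fun _ _ c h => h.add_right c) fun a ha => by
        rw [eq_zero hpos ha]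
        exact RLexLT.irrefl 0

/-- In a total additive order, `a ≥ m` and `b ≥ m'` give `a + b ≥ m + m'`, strictly if either
inequality is strict. -/
lemma IsMonomialOrder.eq_of_add_le {lt : (Fin N → ℕ) → (Fin N → ℕ) → Prop}
    (h : IsMonomialOrder lt) {a b m m' : Fin N → ℕ} (ha : ¬ lt a m) (hb : ¬ lt b m')
    (hab : lt (a + b) (m + m') ∨ a + b = m + m') : a = m ∧ b = m' := by
  have strict_left {a b c d : Fin N → ℕ} (h₁ : lt a b) (h₂ : lt c d ∨ c = d) :
      lt (a + c) (b + d) := by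
    rcases h₂ with h₂ | rfl
    · refine h.trans _ _ _ (h.add_right _ _ c h₁) ?_
      simpa only [add_comm] using h.add_right _ _ b h₂
    · exact h.add_right _ _ c h₁
  have not_lt {x y : Fin N → ℕ} (hxy : lt x y) : ¬ (lt y x ∨ y = x) := by
    rintro (k | rfl)
    · exact h.irrefl _ (h.trans _ _ _ hxy k)
    · exact h.irrefl _ hxy
  have hb' : lt m' b ∨ m' = b := by
    rcases h.trichotomy b m' with k | k | k
    · exact absurd k hb
    · exact Or.inr k.symm
    · exact Or.inl k
  rcases h.trichotomy a m with k | rfl | k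
  · exact absurd k ha
  · rcases hb' with k | rfl
    · refine absurd hab (not_lt ?_)
      simpa only [add_comm] using h.add_right _ _ a k
    · exact ⟨rfl, rfl⟩
  · exact absurd hab (not_lt (strict_left k hb'))

end Order

/-! ### Essential exponents of a filtered module and the comultiplication -/

section Filtration

variable {𝔤 : Type*} [LieRing 𝔤] [LieAlgebra ℂ 𝔤] [FiniteDimensional ℂ 𝔤] [IsKilling ℂ 𝔤]
  {H : LieSubalgebra ℂ 𝔤} [H.IsCartanSubalgebra] {b : (rootSystem H).Base} {N : ℕ}
  (x : Fin N → nMinus b) (lt : (Fin N → ℕ) → (Fin N → ℕ) → Prop)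

lemma nontrivial_quotient_submoduleOf_iff {M : Type*} [AddCommGroup M] [Module ℂ M]
    {P Q : Submodule ℂ M} : Nontrivial (P ⧸ Q.submoduleOf P) ↔ ¬ P ≤ Q := by
  rw [Submodule.Quotient.nontrivial_iff, ne_eq, Submodule.submoduleOf, Submodule.comap_subtype_eq_top]

lemma divMonomial_mem_Ule (m : Fin N → ℕ) : divMonomial x m ∈ Ule x lt m :=
  Submodule.subset_span ⟨m, Or.inr rfl, rfl⟩

/-- `U_{≤ m}` is spanned by `U_{< m}` and one further monomial, so essentiality is a question about
`f^{(m)}` alone. -/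
lemma Ule_le_iff {m : Fin N → ℕ} {P : Submodule ℂ (Un b)} (hP : Ult x lt m ≤ P) :
    Ule x lt m ≤ P ↔ divMonomial x m ∈ P := by
  refine ⟨fun h => h (divMonomial_mem_Ule x lt m), fun h => Submodule.span_le.mpr ?_⟩
  rintro _ ⟨k, hk | rfl, rfl⟩
  · exact hP (Submodule.subset_span ⟨k, hk, rfl⟩)
  · exact h

lemma nontrivial_map_iff {E : Type*} [AddCommGroup E] [Module ℂ E] (F : Un b →ₗ[ℂ] E)
    (m : Fin N → ℕ) :
    Nontrivial ((Ule x lt m).map F ⧸ ((Ult x lt m).map F).submoduleOf ((Ule x lt m).map F)) ↔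
      F (divMonomial x m) ∉ (Ult x lt m).map F := by
  rw [nontrivial_quotient_submoduleOf_iff, Submodule.map_le_iff_le_comap,
    Ule_le_iff x lt (Submodule.map_le_iff_le_comap.mp le_rfl), Submodule.mem_comap]

lemma mem_esU_iff {m : Fin N → ℕ} : m ∈ esU x lt ↔ divMonomial x m ∉ Ult x lt m := by
  rw [esU, Set.mem_ofPred_eq, nontrivial_quotient_submoduleOf_iff, Ule_le_iff x lt le_rfl]

lemma Irrep.isEssential_iff {r : ℕ} {lam : dominantWeights b r} (M : Irrep b r lam)
    {m : Fin N → ℕ} :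
    M.IsEssential x lt m ↔ M.orbitMap (divMonomial x m) ∉ (Ult x lt m).map M.orbitMap :=
  nontrivial_map_iff x lt M.orbitMap m

/-! ### Comultiplication of divided powers -/

section Comul

attribute [local instance] LieRing.ofAssociativeRing

/-- The diagonal map `L → U(L) ⊗ U(L)`, `x ↦ x ⊗ 1 + 1 ⊗ x`. -/
def diagonal (L : Type*) [LieRing L] [LieAlgebra ℂ L] :
    L →ₗ⁅ℂ⁆ UniversalEnvelopingAlgebra ℂ L ⊗[ℂ] UniversalEnvelopingAlgebra ℂ L where
  toFun x := UniversalEnvelopingAlgebra.ι ℂ x ⊗ₜ 1 + 1 ⊗ₜ UniversalEnvelopingAlgebra.ι ℂ x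
  map_add' x y := by
    simp only [map_add, TensorProduct.add_tmul, TensorProduct.tmul_add]
    abel
  map_smul' c x := by
    simp only [map_smul, TensorProduct.smul_tmul', TensorProduct.tmul_smul, smul_add,
      RingHom.id_apply]
  -- The mixed terms cancel because `x ⊗ 1` and `1 ⊗ y` commute.
  map_lie' {x y} := by
    simp only [LieHom.map_lie, LieRing.of_associative_ring_bracket, mul_add, add_mul,
      Algebra.TensorProduct.tmul_mul_tmul, one_mul, mul_one, TensorProduct.sub_tmul,
      TensorProduct.tmul_sub]
    abel

/-- The comultiplication of `U(L)`. -/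
def comul (L : Type*) [LieRing L] [LieAlgebra ℂ L] :
    UniversalEnvelopingAlgebra ℂ L →ₐ[ℂ]
      UniversalEnvelopingAlgebra ℂ L ⊗[ℂ] UniversalEnvelopingAlgebra ℂ L :=
  UniversalEnvelopingAlgebra.lift ℂ (diagonal L)

lemma comul_ι {L : Type*} [LieRing L] [LieAlgebra ℂ L] (x : L) :
    comul L (UniversalEnvelopingAlgebra.ι ℂ x) =
      UniversalEnvelopingAlgebra.ι ℂ x ⊗ₜ 1 + 1 ⊗ₜ UniversalEnvelopingAlgebra.ι ℂ x :=
  UniversalEnvelopingAlgebra.lift_ι_apply ℂ (diagonal L) x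

end Comul

/-- Binomial theorem for the commuting elements `a ⊗ 1` and `1 ⊗ a`; division by `n!` turns each
binomial coefficient into `1 / (p! q!)`. -/
lemma factorial_inv_smul_add_pow {A : Type*} [Ring A] [Algebra ℂ A] (a : A) (n : ℕ) :
    ((n.factorial : ℂ)⁻¹) • (a ⊗ₜ[ℂ] (1 : A) + (1 : A) ⊗ₜ[ℂ] a) ^ n =
      ∑ p ∈ Finset.HasAntidiagonal.antidiagonal n,
        (((p.1.factorial : ℂ)⁻¹) • a ^ p.1) ⊗ₜ[ℂ] (((p.2.factorial : ℂ)⁻¹) • a ^ p.2) := by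
  have hcomm : Commute (a ⊗ₜ[ℂ] (1 : A)) ((1 : A) ⊗ₜ[ℂ] a) := by
    simp [Commute, SemiconjBy]
  rw [hcomm.add_pow', Finset.smul_sum]
  refine Finset.sum_congr rfl fun p hp => ?_
  rw [Finset.HasAntidiagonal.mem_antidiagonal] at hp
  have hfac : ((n.choose p.1 : ℕ) : ℂ) * (p.1.factorial * p.2.factorial) = n.factorial := by
    have := Nat.add_choose_mul_factorial_mul_factorial p.1 p.2
    rw [← Nat.choose_symm_add, hp] at this
    rw [← mul_assoc]
    exact_mod_cast this
  have h₀ : (n.factorial : ℂ) ≠ 0 := by exact_mod_cast n.factorial_ne_zero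
  have h₁ : (p.1.factorial : ℂ) ≠ 0 := by exact_mod_cast p.1.factorial_ne_zero
  have h₂ : (p.2.factorial : ℂ) ≠ 0 := by exact_mod_cast p.2.factorial_ne_zero
  rw [Algebra.TensorProduct.tmul_pow, Algebra.TensorProduct.tmul_pow, one_pow, one_pow,
    Algebra.TensorProduct.tmul_mul_tmul, one_mul, mul_one, TensorProduct.smul_tmul_smul,
    ← Nat.cast_smul_eq_nsmul ℂ, smul_smul]
  congr 1
  field_simp
  rw [← hfac]
  ring

lemma prod_ofFn_tmul {A : Type*} [Ring A] [Algebra ℂ A] :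
    ∀ {n : ℕ} (a c : Fin n → A),
      (List.ofFn fun i => a i ⊗ₜ[ℂ] c i).prod = (List.ofFn a).prod ⊗ₜ[ℂ] (List.ofFn c).prod
  | 0, _, _ => by simp [Algebra.TensorProduct.one_def]
  | n + 1, a, c => by
    simp only [List.ofFn_succ, List.prod_cons, prod_ofFn_tmul,
      Algebra.TensorProduct.tmul_mul_tmul]

/-- The factors need not commute: both tensor legs keep the order of the product, so multilinearity
is enough. -/
lemma comul_divMonomial (m : Fin N → ℕ) :
    comul (nMinus b) (divMonomial x m) =
      ∑ p ∈ Fintype.piFinset fun i => Finset.HasAntidiagonal.antidiagonal (m i),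
        divMonomial x (fun i => (p i).1) ⊗ₜ[ℂ] divMonomial x fun i => (p i).2 := by
  have h := (MultilinearMap.mkPiAlgebraFin ℂ N (Un b ⊗[ℂ] Un b)).map_sum_finset
    (fun i (p : ℕ × ℕ) =>
      (((p.1.factorial : ℂ)⁻¹) • UniversalEnvelopingAlgebra.ι ℂ (x i) ^ p.1) ⊗ₜ[ℂ]
        (((p.2.factorial : ℂ)⁻¹) • UniversalEnvelopingAlgebra.ι ℂ (x i) ^ p.2))
    fun i => Finset.HasAntidiagonal.antidiagonal (m i)
  simp only [MultilinearMap.mkPiAlgebraFin_apply, prod_ofFn_tmul] at h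
  rw [divMonomial, map_list_prod, List.map_ofFn]
  refine Eq.trans ?_ h
  congr 2
  funext i
  rw [Function.comp_apply, map_smul, map_pow, comul_ι, factorial_inv_smul_add_pow]

variable {x lt}

/-- Essential exponents are additive: if `m` is essential for `F`, `m'` for `G`, and the kernel of
`T` is contained in that of `(F ⊗ G) ∘ Δ`, then `m + m'` is essential for `T`. -/
lemma add_essential (hlt : IsMonomialOrder lt) {E₁ E₂ E₃ : Type*}
    [AddCommGroup E₁] [Module ℂ E₁] [AddCommGroup E₂] [Module ℂ E₂] [AddCommGroup E₃] [Module ℂ E₃]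
    {F : Un b →ₗ[ℂ] E₁} {G : Un b →ₗ[ℂ] E₂} {T : Un b →ₗ[ℂ] E₃}
    (hT : ∀ u, T u = 0 → TensorProduct.map F G (comul (nMinus b) u) = 0) {m m' : Fin N → ℕ}
    (hm : F (divMonomial x m) ∉ (Ult x lt m).map F)
    (hm' : G (divMonomial x m') ∉ (Ult x lt m').map G) :
    T (divMonomial x (m + m')) ∉ (Ult x lt (m + m')).map T := by
  -- `φ` and `ψ` read off the graded pieces at `m` and `m'`: they vanish on the lower part but not
  -- on the leading monomial.
  obtain ⟨φ, hφ, hφ'⟩ := Submodule.exists_le_ker_of_notMem hm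
  obtain ⟨ψ, hψ, hψ'⟩ := Submodule.exists_le_ker_of_notMem hm'
  have hφ₀ : ∀ a, lt a m → φ (F (divMonomial x a)) = 0 := fun a ha =>
    hφ' (Submodule.mem_map_of_mem (Submodule.subset_span ⟨a, ha, rfl⟩))
  have hψ₀ : ∀ a, lt a m' → ψ (G (divMonomial x a)) = 0 := fun a ha =>
    hψ' (Submodule.mem_map_of_mem (Submodule.subset_span ⟨a, ha, rfl⟩))
  let θ : Un b →ₗ[ℂ] ℂ := LinearMap.mul' ℂ ℂ ∘ₗ TensorProduct.map φ ψ ∘ₗ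
    TensorProduct.map F G ∘ₗ (comul (nMinus b)).toLinearMap
  have hθ : ∀ k, θ (divMonomial x k) = ∑ p ∈ Fintype.piFinset fun i => Finset.HasAntidiagonal.antidiagonal (k i),
      φ (F (divMonomial x fun i => (p i).1)) * ψ (G (divMonomial x fun i => (p i).2)) := by
    intro k
    simp only [θ, LinearMap.comp_apply, AlgHom.toLinearMap_apply, comul_divMonomial, map_sum,
      TensorProduct.map_tmul, LinearMap.mul'_apply]
  have hterm : ∀ k, (lt k (m + m') ∨ k = m + m') →
      ∀ p ∈ Fintype.piFinset fun i => Finset.HasAntidiagonal.antidiagonal (k i),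
        ¬ ((fun i => (p i).1) = m ∧ (fun i => (p i).2) = m') →
        φ (F (divMonomial x fun i => (p i).1)) * ψ (G (divMonomial x fun i => (p i).2)) = 0 := by
    intro k hk p hp hne
    have hpk : (fun i => (p i).1) + (fun i => (p i).2) = k := by
      funext i
      simpa using Fintype.mem_piFinset.mp hp i
    by_contra hc
    refine hne (hlt.eq_of_add_le (fun h => hc ?_) (fun h => hc ?_) (by rwa [hpk]))
    · rw [hφ₀ _ h, zero_mul]
    · rw [hψ₀ _ h, mul_zero]
  have hlow : Ult x lt (m + m') ≤ LinearMap.ker θ := by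
    refine Submodule.span_le.mpr ?_
    rintro _ ⟨k, hk, rfl⟩
    rw [SetLike.mem_coe, LinearMap.mem_ker, hθ]
    refine Finset.sum_eq_zero fun p hp => hterm k (Or.inl hk) p hp ?_
    rintro ⟨h₁, h₂⟩
    have hpk : (fun i => (p i).1) + (fun i => (p i).2) = k := by
      funext i
      simpa using Fintype.mem_piFinset.mp hp i
    rw [h₁, h₂] at hpk
    exact hlt.irrefl _ (hpk ▸ hk)
  have htop : θ (divMonomial x (m + m')) ≠ 0 := by
    rw [hθ, Finset.sum_eq_single fun i => (m i, m' i)]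
    · exact mul_ne_zero hφ hψ
    · intro p hp hne
      refine hterm _ (Or.inr rfl) p hp ?_
      rintro ⟨h₁, h₂⟩
      exact hne (funext fun i => Prod.ext (congrFun h₁ i) (congrFun h₂ i))
    · intro h
      exact absurd (Fintype.mem_piFinset.mpr fun i => by simp) h
  -- If a lower `w` had the same image under `T`, then `f^{(m+m')} - w` would lie in `ker T`, hence
  -- in `ker θ`; but `θ` kills `w` and not the monomial.
  rintro ⟨w, hw, hwT⟩
  have hker : T (divMonomial x (m + m') - w) = 0 := by rw [map_sub, hwT, sub_self]
  have : θ (divMonomial x (m + m') - w) = 0 := by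
    simp only [θ, LinearMap.comp_apply, AlgHom.toLinearMap_apply, hT _ hker, map_zero]
  rw [map_sub, LinearMap.mem_ker.mp (hlow hw), sub_zero] at this
  exact htop this

lemma divMonomial_zero : divMonomial x (0 : Fin N → ℕ) = 1 := by
  simp [divMonomial]

lemma Ult_zero (hlt : IsMonomialOrder lt) : Ult x lt 0 = ⊥ := by
  rw [Ult, Submodule.span_eq_bot]
  rintro _ ⟨k, hk, rfl⟩
  exact absurd hk (hlt.not_zero k)

lemma add_mem_esU (hlt : IsMonomialOrder lt) {m m' : Fin N → ℕ} (hm : m ∈ esU x lt)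
    (hm' : m' ∈ esU x lt) : m + m' ∈ esU x lt := by
  rw [mem_esU_iff] at hm hm' ⊢
  have := add_essential (F := LinearMap.id) (G := LinearMap.id) (T := LinearMap.id) hlt
    (by rintro u rfl; simp) (by simpa using hm) (by simpa using hm')
  simpa using this

end Filtration

end EssentialMonoid

namespace EssentialMonoid

open LieModule Module

/-! ### The Casimir operator -/

section Casimir

variable {L : Type*} [LieRing L] [LieAlgebra ℂ L]

/-- Two families which are dual to each other for the Killing form. -/
def IsDualFamily {ι : Type*} [Fintype ι] (e e' : ι → L) : Prop :=
  ∀ x, ∑ i, killingForm ℂ L x (e' i) • e i = x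

/-- By nondegeneracy it suffices to pair the difference of both sides with each `y`, expanded in the
family `e`. -/
lemma IsDualFamily.symm [IsKilling ℂ L] {ι : Type*} [Fintype ι] {e e' : ι → L} (h : IsDualFamily e e') :
    IsDualFamily e' e := by
  intro x
  have hcomm : ∀ y z : L, killingForm ℂ L y z = killingForm ℂ L z y := traceForm_comm ℂ L L
  rw [← sub_eq_zero, ← Submodule.mem_bot (R := ℂ), ← LieAlgebra.IsKilling.ker_killingForm_eq_bot ℂ L,
    LinearMap.mem_ker]
  ext y
  rw [LinearMap.zero_apply, map_sub, LinearMap.sub_apply, sub_eq_zero, hcomm x y]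
  conv_rhs => rw [← h y]
  simp only [map_sum, map_smul, LinearMap.sum_apply, LinearMap.smul_apply, smul_eq_mul]
  exact Finset.sum_congr rfl fun i _ => by rw [hcomm x, hcomm (e' i), mul_comm]

/-- The Casimir operator `∑ eᵢ e'ᵢ`. -/
def casimir {ι : Type*} [Fintype ι] (e e' : ι → L) (Z : Type*) [AddCommGroup Z] [Module ℂ Z]
    [LieRingModule L Z] [LieModule ℂ L Z] : Module.End ℂ Z :=
  ∑ i, toEnd ℂ L Z (e i) ∘ₗ toEnd ℂ L Z (e' i)

variable {Z : Type*} [AddCommGroup Z] [Module ℂ Z] [LieRingModule L Z] [LieModule ℂ L Z]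

lemma casimir_apply {ι : Type*} [Fintype ι] (e e' : ι → L) (w : Z) :
    casimir e e' Z w = ∑ i, ⁅e i, ⁅e' i, w⁆⁆ := by
  simp [casimir]

/-- Commuting `x` past the Casimir leaves terms in `[x, eᵢ]` and in `[x, e'ᵢ]`. Expanded in the dual
families, their coefficients are opposite by invariance of the Killing form. -/
lemma casimir_lie [IsKilling ℂ L] {ι : Type*} [Fintype ι] {e e' : ι → L} (h : IsDualFamily e e') (x : L) (w : Z) :
    casimir e e' Z ⁅x, w⁆ = ⁅x, casimir e e' Z w⁆ := by
  have hcomm : ∀ y z : L, killingForm ℂ L y z = killingForm ℂ L z y := traceForm_comm ℂ L L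
  have hinv : ∀ y z : L, killingForm ℂ L ⁅x, y⁆ z = -killingForm ℂ L ⁅x, z⁆ y := by
    intro y z
    rw [← lie_skew, map_neg, LinearMap.neg_apply, hcomm ⁅x, z⁆]
    exact congrArg Neg.neg (traceForm_apply_lie_apply ℂ L L y x z)
  have h₁ : ∑ i, ⁅⁅x, e i⁆, ⁅e' i, w⁆⁆ =
      ∑ i, ∑ j, killingForm ℂ L ⁅x, e i⁆ (e' j) • ⁅e j, ⁅e' i, w⁆⁆ := by
    refine Finset.sum_congr rfl fun i _ => ?_
    conv_lhs => rw [← h ⁅x, e i⁆]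
    rw [sum_lie]
    simp only [smul_lie]
  have h₂ : ∑ i, ⁅e i, ⁅⁅x, e' i⁆, w⁆⁆ =
      ∑ i, ∑ j, killingForm ℂ L ⁅x, e' i⁆ (e j) • ⁅e i, ⁅e' j, w⁆⁆ := by
    refine Finset.sum_congr rfl fun i _ => ?_
    conv_lhs => rw [← h.symm ⁅x, e' i⁆]
    rw [sum_lie, lie_sum]
    simp only [smul_lie, lie_smul]
  have h₃ : ∑ i, ⁅⁅x, e i⁆, ⁅e' i, w⁆⁆ + ∑ i, ⁅e i, ⁅⁅x, e' i⁆, w⁆⁆ = 0 := by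
    rw [h₁, h₂, Finset.sum_comm, ← Finset.sum_add_distrib]
    refine Finset.sum_eq_zero fun i _ => ?_
    rw [← Finset.sum_add_distrib]
    refine Finset.sum_eq_zero fun j _ => ?_
    rw [hinv, ← add_smul, neg_add_cancel, zero_smul]
  have h₄ : ⁅x, casimir e e' Z w⁆ = (∑ i, ⁅⁅x, e i⁆, ⁅e' i, w⁆⁆ + ∑ i, ⁅e i, ⁅⁅x, e' i⁆, w⁆⁆) +
      ∑ i, ⁅e i, ⁅e' i, ⁅x, w⁆⁆⁆ := by
    rw [casimir_apply, lie_sum, ← Finset.sum_add_distrib, ← Finset.sum_add_distrib]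
    refine Finset.sum_congr rfl fun i _ => ?_
    rw [leibniz_lie x (e i), leibniz_lie x (e' i), lie_add, add_assoc]
  rw [h₄, h₃, zero_add, casimir_apply]

end Casimir

variable {𝔤 : Type*} [LieRing 𝔤] [LieAlgebra ℂ 𝔤] [FiniteDimensional ℂ 𝔤] [IsKilling ℂ 𝔤]
  {H : LieSubalgebra ℂ 𝔤} [H.IsCartanSubalgebra]

/-! ### The form on the dual of the Cartan subalgebra -/

section Form

lemma apply_cartanEquivDual_symm (ν : Dual ℂ H) (h : H) :
    traceForm ℂ H 𝔤 ((cartanEquivDual H).symm ν) h = ν h :=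
  LinearMap.BilinForm.apply_toDual_symm_apply (hB := traceForm_cartan_nondegenerate ℂ 𝔤 H) ν h

/-- Throughout, `ν ((cartanEquivDual H).symm μ)` plays the role of the symmetric form `(ν, μ)` on
the dual of `H`. -/
lemma apply_cartanEquivDual_symm_comm (ν μ : Dual ℂ H) :
    ν ((cartanEquivDual H).symm μ) = μ ((cartanEquivDual H).symm ν) := by
  rw [← apply_cartanEquivDual_symm, traceForm_comm, apply_cartanEquivDual_symm]

lemma apply_cartanEquivDual_symm_root (ν : Dual ℂ H) (α : H.root) :
    ν ((cartanEquivDual H).symm α.1) =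
      α.1 ((cartanEquivDual H).symm α.1) / 2 * ν ((rootSystem H).coroot α) := by
  have hα := root_apply_cartanEquivDual_symm_ne_zero (LieSubalgebra.isNonZero_coe_root α)
  rw [rootSystem_coroot_apply, coroot, map_nsmul, map_smul, smul_eq_mul, nsmul_eq_mul]
  field_simp
  norm_cast

open scoped ComplexOrder

/-- With `q = (α, α)`, the Killing form gives `q = ∑ (β, α)²` over the roots, and `(β, α) = (q / 2)
n_β` with `n_β` an integer. Hence `1 / q = ∑ (n_β / 2)²` is real and nonnegative. The order on `ℂ`
includes the claim that `q` is real. -/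
lemma root_apply_cartanEquivDual_symm_pos (α : H.root) :
    0 < α.1 ((cartanEquivDual H).symm α.1) := by
  set q := α.1 ((cartanEquivDual H).symm α.1) with hq
  have hq₀ : q ≠ 0 := root_apply_cartanEquivDual_symm_ne_zero (LieSubalgebra.isNonZero_coe_root α)
  have hsum : q = ∑ β : H.root, β.1 ((cartanEquivDual H).symm α.1) *
      β.1 ((cartanEquivDual H).symm α.1) := by
    have h := LinearMap.congr_fun₂ (restrict_killingForm_eq_sum (K := ℂ) (L := 𝔤) (H := H))
      ((cartanEquivDual H).symm α.1) ((cartanEquivDual H).symm α.1)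
    rw [LieAlgebra.restrict_killingForm, apply_cartanEquivDual_symm] at h
    rw [hq, ← Weight.toLinear_apply, h, ← Finset.sum_coe_sort]
    simp only [LinearMap.sum_apply, LinearMap.smulRight_apply, LinearMap.smul_apply, smul_eq_mul]
    rfl
  have hint : ∀ β : H.root, ∃ n : ℤ, β.1 ((cartanEquivDual H).symm α.1) = q / 2 * n := by
    intro β
    refine ⟨(rootSystem H).pairingIn ℤ β α, ?_⟩
    have h := apply_cartanEquivDual_symm_root (β.1 : Dual ℂ H) α
    rw [Weight.toLinear_apply] at h
    rw [h, ← eq_intCast (algebraMap ℤ ℂ), RootPairing.algebraMap_pairingIn]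
    rfl
  choose n hn using hint
  have hinv : q⁻¹ = ∑ β, ((n β : ℂ) / 2) * (n β / 2) := by
    have h' : q = q * q * ∑ β, ((n β : ℂ) / 2) * (n β / 2) := by
      conv_lhs => rw [hsum]
      rw [Finset.mul_sum]
      refine Finset.sum_congr rfl fun β _ => ?_
      rw [hn]
      ring
    field_simp at h' ⊢
    linear_combination h'
  have hnonneg : 0 ≤ q⁻¹ := by
    rw [hinv]
    refine Finset.sum_nonneg fun β _ => ?_
    have : ((n β : ℂ) / 2) * (n β / 2) = (((n β : ℝ) / 2) * (n β / 2) : ℝ) := by push_cast; ring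
    rw [this]
    exact Complex.zero_le_real.mpr (mul_self_nonneg _)
  exact inv_pos.mp (lt_of_le_of_ne hnonneg (inv_ne_zero hq₀).symm)

variable (b : (rootSystem H).Base)

open Classical in
/-- The sum `2ρ` of the positive roots. -/
def twoRho : Dual ℂ H := ∑ α : H.root with b.IsPos α, (rootSystem H).root α

variable {b}

/-- The simple reflection `s_j` permutes the positive roots other than `α_j` and negates their
pairing with the coroot of `j`. Those terms cancel in pairs, leaving `⟨α_j, α_j^∨⟩ = 2`. -/
lemma twoRho_apply_coroot {j : H.root} (hj : j ∈ b.support) :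
    twoRho b ((rootSystem H).coroot j) = 2 := by
  classical
  have hpair : ∀ i : H.root, (rootSystem H).root i ((rootSystem H).coroot j) =
      (rootSystem H).pairing i j := fun i => rfl
  rw [twoRho, LinearMap.sum_apply, ← Finset.add_sum_erase _ _ (a := j)
    (by simpa using b.isPos_of_mem_support hj)]
  simp only [hpair, RootPairing.pairing_same]
  have hneg : ∀ i, (rootSystem H).pairing ((rootSystem H).reflectionPerm j i) j =
      -(rootSystem H).pairing i j := by
    intro i
    rw [← RootPairing.pairing_reflectionPerm, RootPairing.pairing_reflectionPerm_self_right]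
  rw [Finset.sum_involution (fun i _ => (rootSystem H).reflectionPerm j i), add_zero]
  · intro i _
    rw [hneg, add_neg_cancel]
  -- A root fixed by the involution has a pairing equal to its own negative, hence zero.
  · intro i _ hi h
    have := hneg i
    rw [h] at this
    exact hi (by linear_combination (1 / 2 : ℂ) * this)
  · intro i hi
    simp only [Finset.mem_erase, Finset.mem_filter, Finset.mem_univ, true_and] at hi ⊢
    refine ⟨fun h => hi.1 ?_, hi.2.reflectionPerm hj hi.1⟩
    have hi' := hi.2
    rw [← RootPairing.reflectionPerm_self (rootSystem H) j i, h] at hi'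
    exact absurd (b.isPos_of_mem_support hj) ((RootPairing.Base.IsPos.neg_iff_not b j).mp hi')
  · intro i _
    exact RootPairing.reflectionPerm_self _ _ _

lemma root_apply_twoRho_pos {α : H.root} (hα : b.IsPos α) :
    0 < (rootSystem H).root α ((cartanEquivDual H).symm (twoRho b)) := by
  have hsimple : ∀ j ∈ b.support,
      0 < (rootSystem H).root j ((cartanEquivDual H).symm (twoRho b)) := by
    intro j hj
    rw [apply_cartanEquivDual_symm_comm, rootSystem_root_apply, apply_cartanEquivDual_symm_root,
      twoRho_apply_coroot hj, div_mul_cancel₀ _ two_ne_zero]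
    exact root_apply_cartanEquivDual_symm_pos j
  refine hα.induction_on_add
    (p := fun i => 0 < (rootSystem H).root i ((cartanEquivDual H).symm (twoRho b))) hsimple ?_
  intro i j k hk hi hj
  rw [hk, LinearMap.add_apply]
  exact add_pos hi (hsimple j hj)

variable (b) in
/-- The semigroup generated by the positive roots. -/
def posCone : AddSubsemigroup (Dual ℂ H) :=
  AddSubsemigroup.closure {μ | ∃ β : PosRoot b, μ = (rootSystem H).root β.1}

lemma root_mem_posCone (β : PosRoot b) : (rootSystem H).root β.1 ∈ posCone b :=
  AddSubsemigroup.subset_closure ⟨β, rfl⟩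

/-- Strictness relies on `posCone` being a semigroup: the empty sum of roots is excluded. -/
lemma apply_twoRho_pos {c : Dual ℂ H} (hc : c ∈ posCone b) :
    0 < c ((cartanEquivDual H).symm (twoRho b)) := by
  induction hc using AddSubsemigroup.closure_induction with
  | mem _ h => obtain ⟨β, rfl⟩ := h; exact root_apply_twoRho_pos β.2
  | add _ _ _ _ h h' => rw [LinearMap.add_apply]; exact add_pos h h'

lemma apply_nonneg_of_mem_posCone {ν c : Dual ℂ H}
    (hν : ∀ β : PosRoot b, ∃ n : ℕ, ν ((rootSystem H).coroot β.1) = n) (hc : c ∈ posCone b) :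
    0 ≤ c ((cartanEquivDual H).symm ν) := by
  induction hc using AddSubsemigroup.closure_induction with
  | mem _ h =>
    obtain ⟨β, rfl⟩ := h
    obtain ⟨n, hn⟩ := hν β
    rw [apply_cartanEquivDual_symm_comm, rootSystem_root_apply, apply_cartanEquivDual_symm_root, hn]
    exact mul_nonneg (div_nonneg (root_apply_cartanEquivDual_symm_pos β.1).le zero_le_two)
      (Nat.cast_nonneg n)
  | add _ _ _ _ h h' => rw [LinearMap.add_apply]; exact add_nonneg h h'

end Form

end EssentialMonoid

namespace EssentialMonoid

open LieModule Module

variable {𝔤 : Type*} [LieRing 𝔤] [LieAlgebra ℂ 𝔤] [FiniteDimensional ℂ 𝔤] [IsKilling ℂ 𝔤]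
  {H : LieSubalgebra ℂ 𝔤} [H.IsCartanSubalgebra]

/-! ### Root decomposition and the Casimir eigenvalue of a highest weight vector -/

section Decomposition

lemma eq_top_of_cartan_le_of_rootSpace_le {P : Submodule ℂ 𝔤} (hH : ∀ h : H, (h : 𝔤) ∈ P)
    (hroot : ∀ α : H.root, (rootSpace H (α.1 : H → ℂ)).toSubmodule ≤ P) : P = ⊤ := by
  have htop := congrArg LieSubmodule.toSubmodule (iSup_genWeightSpace_eq_top' ℂ H 𝔤)
  rw [LieSubmodule.iSup_toSubmodule, LieSubmodule.top_toSubmodule] at htop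
  rw [← top_le_iff, ← htop]
  refine iSup_le fun χ => ?_
  by_cases hχ : χ.IsZero
  · intro y hy
    have hy' : y ∈ rootSpace H (0 : H → ℂ) := by
      rw [← hχ.eq]
      exact hy
    rw [rootSpace_zero_eq, LieSubalgebra.mem_toLieSubmodule] at hy'
    exact hH ⟨y, hy'⟩
  · exact hroot ⟨χ, by simpa [LieSubalgebra.root] using hχ⟩

lemma neg_isPos (b : (rootSystem H).Base) {α : H.root} (hα : ¬ b.IsPos α) :
    ∃ β : PosRoot b, (α.1 : H → ℂ) = -(β.1.1 : H → ℂ) := by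
  refine ⟨⟨(rootSystem H).reflectionPerm α α, (RootPairing.Base.IsPos.neg_iff_not b α).mpr hα⟩, ?_⟩
  have h : (rootSystem H).root ((rootSystem H).reflectionPerm α α) = -(rootSystem H).root α := by
    rw [RootPairing.root_reflectionPerm, RootPairing.reflection_apply_self]
  funext x
  have hx := LinearMap.congr_fun h x
  simp only [rootSystem_root_apply, LinearMap.neg_apply, Weight.toLinear_apply] at hx
  simp [hx]

lemma eq_top_of_cartan_le_of_posSpace_le_of_negSpace_le (b : (rootSystem H).Base)
    {P : Submodule ℂ 𝔤} (hH : ∀ h : H, (h : 𝔤) ∈ P) (hpos : ∀ β : PosRoot b, posSpace b β ≤ P)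
    (hneg : ∀ β : PosRoot b, negSpace b β ≤ P) : P = ⊤ := by
  refine eq_top_of_cartan_le_of_rootSpace_le hH fun α => ?_
  by_cases hα : b.IsPos α
  · exact hpos ⟨α, hα⟩
  · obtain ⟨β, hβ⟩ := neg_isPos b hα
    rw [hβ]
    exact hneg β

/-- A nonzero `e` in `𝔤_α` orthogonal to `𝔤_{-α}` would lie in the kernel of the Killing form. -/
lemma exists_dual_root_vectors (α : H.root) :
    ∃ e ∈ rootSpace H (α.1 : H → ℂ), ∃ e' ∈ rootSpace H (-(α.1 : H → ℂ)),
      killingForm ℂ 𝔤 e e' = 1 := by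
  obtain ⟨e, heα, he₀⟩ := α.1.exists_ne_zero
  obtain ⟨f, hfα, hf⟩ : ∃ f ∈ rootSpace H (-(α.1 : H → ℂ)), killingForm ℂ 𝔤 e f ≠ 0 := by
    contrapose! he₀
    simpa using mem_ker_killingForm_of_mem_rootSpace_of_forall_rootSpace_neg ℂ 𝔤 H heα he₀
  exact ⟨e, heα, (killingForm ℂ 𝔤 e f)⁻¹ • f, Submodule.smul_mem _ _ hfα, by
    rw [map_smul, smul_eq_mul, inv_mul_cancel₀ hf]⟩

variable (H) in
/-- A basis of the Cartan subalgebra and its dual basis. -/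
lemma exists_dual_cartan_basis :
    ∃ (n : ℕ) (h h' : Fin n → H), ∀ x : H, ∑ i, traceForm ℂ H 𝔤 x (h' i) • h i = x := by
  let v := Module.finBasis ℂ H
  let v' := LinearMap.BilinForm.dualBasis (traceForm ℂ H 𝔤)
    (traceForm_cartan_nondegenerate ℂ 𝔤 H) v
  refine ⟨_, v', v, fun x => ?_⟩
  conv_rhs => rw [← v'.sum_repr x]
  refine Finset.sum_congr rfl fun i _ => ?_
  rw [LinearMap.BilinForm.dualBasis_repr_apply]

end Decomposition

/-- A vector of weight `lam` which is annihilated by the positive root spaces. -/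
structure IsHighestWeightVector (b : (rootSystem H).Base) (lam : Dual ℂ H) {Z : Type*}
    [AddCommGroup Z] [Module ℂ Z] [LieRingModule 𝔤 Z] (z : Z) : Prop where
  pos : ∀ β : PosRoot b, ∀ x ∈ posSpace b β, ⁅x, z⁆ = 0
  weight : ∀ h : H, ⁅(h : 𝔤), z⁆ = lam h • z

section Eigenvalue

variable {b : (rootSystem H).Base} {Z : Type*} [AddCommGroup Z] [Module ℂ Z] [LieRingModule 𝔤 Z]
  [LieModule ℂ 𝔤 Z]

variable (H) in
/-- There is a dual pair of families of `𝔤` whose Casimir operator acts on highest weight vectors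
of weight `lam` by the scalar `(lam, lam + 2ρ)`. -/
lemma exists_casimir : ∃ (n : ℕ) (e e' : H.root ⊕ Fin n → 𝔤), IsDualFamily e e' ∧
    ∀ (b : (rootSystem H).Base) (Z : Type*) [AddCommGroup Z] [Module ℂ Z] [LieRingModule 𝔤 Z]
      [LieModule ℂ 𝔤 Z] (lam : Dual ℂ H) (z : Z), IsHighestWeightVector b lam z →
      casimir e e' Z z = (lam ((cartanEquivDual H).symm lam) +
        lam ((cartanEquivDual H).symm (twoRho b))) • z := by
  obtain ⟨n, h, h', hh⟩ := exists_dual_cartan_basis H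
  choose e he e' he' hee' using exists_dual_root_vectors (H := H)
  have hH₀ : ∀ x : H, (x : 𝔤) ∈ rootSpace H (0 : H → ℂ) := fun x => by
    rw [rootSpace_zero_eq, LieSubalgebra.mem_toLieSubmodule]
    exact x.2
  have hne : ∀ α : H.root, (α.1 : H → ℂ) ≠ 0 := fun α => LieSubalgebra.isNonZero_coe_root α
  refine ⟨n, Sum.elim e fun i => h i, Sum.elim e' fun i => h' i, ?_, ?_⟩
  -- Duality says that `D` is the identity. This is checked on `H` and on each root space, where
  -- orthogonality of `𝔤_α` and `𝔤_β` for `α + β ≠ 0` removes all other terms.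
  · let D : 𝔤 →ₗ[ℂ] 𝔤 := ∑ α, ((killingForm ℂ 𝔤).flip (e' α)).smulRight (e α) +
      ∑ i, ((killingForm ℂ 𝔤).flip (h' i)).smulRight (h i : 𝔤)
    have hD : ∀ y, D y = ∑ α, killingForm ℂ 𝔤 y (e' α) • e α +
        ∑ i, killingForm ℂ 𝔤 y (h' i) • (h i : 𝔤) := fun y => by
      simp [D, LinearMap.sum_apply]
    have htop : LinearMap.eqLocus D LinearMap.id = ⊤ := by
      refine eq_top_of_cartan_le_of_rootSpace_le (H := H) (fun x => ?_) fun α y hy => ?_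
      · rw [LinearMap.mem_eqLocus, hD, LinearMap.id_apply, Finset.sum_eq_zero, zero_add]
        · have hx := congrArg H.toSubmodule.subtype (hh x)
          rw [map_sum] at hx
          exact hx
        · intro β _
          rw [killingForm_apply_eq_zero_of_mem_rootSpace_of_add_ne_zero ℂ 𝔤 H (hH₀ x) (he' β)
            (by simp [hne β]), zero_smul]
      · rw [LinearMap.mem_eqLocus, hD, LinearMap.id_apply, Finset.sum_eq_single α, add_eq_left.mpr]
        · have he₀ : (⟨e α, he α⟩ : rootSpace H (α.1 : H → ℂ)) ≠ 0 := by
            intro h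
            have h₀ : e α = 0 := congrArg Subtype.val h
            simpa [h₀] using hee' α
          obtain ⟨c, hc⟩ := (finrank_eq_one_iff_of_nonzero' _ he₀).mp
            (finrank_rootSpace_eq_one α.1 (LieSubalgebra.isNonZero_coe_root α)) ⟨y, hy⟩
          have hc' : c • e α = y := congrArg Subtype.val hc
          rw [← hc', map_smul, LinearMap.smul_apply, hee', smul_eq_mul, mul_one]
        · refine Finset.sum_eq_zero fun i _ => ?_
          rw [killingForm_apply_eq_zero_of_mem_rootSpace_of_add_ne_zero ℂ 𝔤 H hy (hH₀ (h' i))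
            (by simp [hne α]), zero_smul]
        · intro β _ hβ
          rw [killingForm_apply_eq_zero_of_mem_rootSpace_of_add_ne_zero ℂ 𝔤 H hy (he' β), zero_smul]
          intro h
          exact hβ (Subtype.ext (DFunLike.coe_injective (add_neg_eq_zero.mp h)).symm)
        · simp
    intro y
    have hy : y ∈ LinearMap.eqLocus D LinearMap.id := htop ▸ Submodule.mem_top
    rw [LinearMap.mem_eqLocus, hD, LinearMap.id_apply] at hy
    simpa [Fintype.sum_sum_type] using hy
  · intro b Z _ _ _ _ lam z hz
    classical
    rw [casimir_apply, Fintype.sum_sum_type, add_smul, add_comm]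
    congr 1
    · simp only [Sum.elim_inr, hz.weight, lie_smul, smul_smul, ← Finset.sum_smul]
      congr 1
      conv_rhs => rw [← hh ((cartanEquivDual H).symm lam)]
      rw [map_sum]
      refine Finset.sum_congr rfl fun i _ => ?_
      rw [map_smul, apply_cartanEquivDual_symm, smul_eq_mul]
    -- For positive `α`, `e e' z = [e, e'] z = (λ, α) z`, since `e` kills `z`. Otherwise `e'` is a
    -- positive root vector and kills `z`. The sum is `(λ, 2ρ)`.
    · rw [apply_cartanEquivDual_symm_comm, twoRho, LinearMap.sum_apply, Finset.sum_smul,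
        Finset.sum_filter]
      refine Finset.sum_congr rfl fun α _ => ?_
      rw [Sum.elim_inl, Sum.elim_inl]
      split_ifs with hα
      · rw [leibniz_lie, hz.pos ⟨α, hα⟩ _ (he α), lie_zero, add_zero,
          lie_eq_killingForm_smul_of_mem_rootSpace_of_mem_rootSpace_neg (he α) (he' α), hee',
          one_smul, hz.weight, apply_cartanEquivDual_symm_comm]
        rfl
      · obtain ⟨β, hβ⟩ := neg_isPos b hα
        have : ⁅e' α, z⁆ = 0 := hz.pos β _ (by
          have := he' α
          rwa [hβ, neg_neg] at this)
        rw [this, lie_zero]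

end Eigenvalue

end EssentialMonoid

namespace EssentialMonoid

open LieModule Module

variable {𝔤 : Type*} [LieRing 𝔤] [LieAlgebra ℂ 𝔤] [FiniteDimensional ℂ 𝔤] [IsKilling ℂ 𝔤]
  {H : LieSubalgebra ℂ 𝔤} [H.IsCartanSubalgebra] {b : (rootSystem H).Base}
  {Z : Type*} [AddCommGroup Z] [Module ℂ Z] [LieRingModule 𝔤 Z] [LieModule ℂ 𝔤 Z]

/-! ### Irreducibility of cyclic highest weight modules -/

section Irreducible

/-- The vector is primitive for the `sl₂`-triple of `β`, and finite dimension forces a natural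
eigenvalue. -/
lemma IsHighestWeightVector.exists_nat [FiniteDimensional ℂ Z] {lam : Dual ℂ H} {z : Z}
    (hz : IsHighestWeightVector b lam z) (hz₀ : z ≠ 0) (β : PosRoot b) :
    ∃ n : ℕ, lam ((rootSystem H).coroot β.1) = n := by
  have hβ := LieSubalgebra.isNonZero_coe_root β.1
  obtain ⟨h, e, f, ht, he, hf⟩ := exists_isSl2Triple_of_weight_isNonZero hβ
  have P : ht.HasPrimitiveVectorWith z (lam ((rootSystem H).coroot β.1)) :=
    { ne_zero := hz₀
      lie_h := by rw [ht.h_eq_coroot hβ he hf, hz.weight, rootSystem_coroot_apply]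
      lie_e := hz.pos β e he }
  exact P.exists_nat

/-- Every nonzero finite dimensional module contains a highest weight vector. -/
lemma exists_isHighestWeightVector (b : (rootSystem H).Base) (Z : Type*) [AddCommGroup Z]
    [Module ℂ Z] [LieRingModule 𝔤 Z] [LieModule ℂ 𝔤 Z] [FiniteDimensional ℂ Z] [Nontrivial Z] :
    ∃ (ν : Dual ℂ H) (z : Z), z ≠ 0 ∧ IsHighestWeightVector b ν z := by
  have hne : Nonempty (Weight ℂ H Z) := by
    by_contra hc
    rw [not_nonempty_iff] at hc
    have := iSup_genWeightSpace_eq_top' ℂ H Z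
    rw [iSup_of_empty] at this
    exact bot_ne_top this
  set h₀ := (cartanEquivDual H).symm (twoRho b) with hh₀
  -- Adding a positive root strictly increases the value at `h₀`, so at a maximal weight every
  -- positive root vector acts by zero.
  obtain ⟨χ, hχ⟩ := Finite.exists_max fun χ : Weight ℂ H Z => (χ h₀).re
  obtain ⟨z, hz₀, hz⟩ := exists_forall_lie_eq_smul ℂ H Z χ
  refine ⟨χ.toLinear, z, hz₀, fun β x hx => ?_, hz⟩
  by_contra hne
  have hzχ : z ∈ genWeightSpace Z (χ : H → ℂ) :=
    weightSpace_le_genWeightSpace Z χ ((mem_weightSpace _ z).mpr hz)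
  have hmem := lie_mem_genWeightSpace_of_mem_genWeightSpace hx hzχ
  have hbot : genWeightSpace Z ((β.1.1 : H → ℂ) + (χ : H → ℂ)) ≠ ⊥ := by
    intro h
    rw [h] at hmem
    exact hne (by simpa using hmem)
  have hle := hχ ⟨_, hbot⟩
  have hpos := (Complex.lt_def.mp (root_apply_twoRho_pos β.2)).1
  rw [← hh₀, rootSystem_root_apply, Weight.toLinear_apply, Complex.zero_re] at hpos
  change ((β.1.1 : H → ℂ) h₀ + χ h₀).re ≤ (χ h₀).re at hle
  rw [Complex.add_re] at hle
  linarith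

/-- The vectors obtained from `z` by applying negative root vectors. -/
inductive Descendant (b : (rootSystem H).Base) (z : Z) : Z → Prop
  | base : Descendant b z z
  | step (β : PosRoot b) (y : 𝔤) (hy : y ∈ negSpace b β) (w : Z) (hw : Descendant b z w) :
      Descendant b z ⁅y, w⁆

/-- Induction through `x y w = [x, y] w + y (x w)`. The element `x` must stay arbitrary, since the
hypothesis is applied to `[x, y]` as well. -/
lemma IsHighestWeightVector.lie_descendant_mem {lam : Dual ℂ H} {z : Z}
    (hz : IsHighestWeightVector b lam z) (x : 𝔤) {w : Z} (hw : Descendant b z w) :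
    ⁅x, w⁆ ∈ Submodule.span ℂ {w | Descendant b z w} := by
  set P := Submodule.span ℂ {w | Descendant b z w} with hP
  have hstable : ∀ (β : PosRoot b), ∀ y ∈ negSpace b β, ∀ w ∈ P, ⁅y, w⁆ ∈ P := by
    intro β y hy w hw
    induction hw using Submodule.span_induction with
    | mem w hw => exact Submodule.subset_span (Descendant.step β y hy w hw)
    | zero => rw [lie_zero]; exact P.zero_mem
    | add u v _ _ hu hv => rw [lie_add]; exact P.add_mem hu hv
    | smul c u _ hu => rw [lie_smul]; exact P.smul_mem c hu
  induction hw generalizing x with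
  | base =>
    let act : 𝔤 →ₗ[ℂ] Z :=
      { toFun := fun x => ⁅x, z⁆
        map_add' := fun x y => add_lie x y z
        map_smul' := fun c x => smul_lie c x z }
    have htop : P.comap act = ⊤ := by
      refine eq_top_of_cartan_le_of_posSpace_le_of_negSpace_le b (fun h => ?_)
        (fun β y hy => ?_) fun β y hy => ?_
      · change ⁅(h : 𝔤), z⁆ ∈ P
        rw [hz.weight]
        exact P.smul_mem _ (Submodule.subset_span Descendant.base)
      · change ⁅y, z⁆ ∈ P
        rw [hz.pos β y hy]
        exact P.zero_mem
      · exact Submodule.subset_span (Descendant.step β y hy z Descendant.base)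
    exact Submodule.eq_top_iff'.mp htop x
  | step β y hy w hw ih =>
    rw [leibniz_lie]
    exact P.add_mem (ih _) (hstable β y hy _ (ih x))

lemma IsHighestWeightVector.descendant_eq_or {lam : Dual ℂ H} {z w : Z}
    (hz : IsHighestWeightVector b lam z) (hw : Descendant b z w) :
    w = z ∨ ∃ c ∈ posCone b, ∀ h : H, ⁅(h : 𝔤), w⁆ = (lam - c) h • w := by
  induction hw with
  | base => exact Or.inl rfl
  | step β y hy w hw ih =>
    right
    have hy' : ∀ h : H, ⁅(h : 𝔤), y⁆ = -(β.1.1 h) • y := fun h => lie_eq_smul_of_mem_rootSpace hy h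
    rcases ih with rfl | ⟨c, hc, hcw⟩
    · refine ⟨_, root_mem_posCone β, fun h => ?_⟩
      rw [leibniz_lie, hy', hz.weight, smul_lie, lie_smul, ← add_smul, rootSystem_root_apply,
        LinearMap.sub_apply, Weight.toLinear_apply, neg_add_eq_sub]
    · refine ⟨_, add_mem hc (root_mem_posCone β), fun h => ?_⟩
      rw [leibniz_lie, hy', hcw, smul_lie, lie_smul, ← add_smul, rootSystem_root_apply,
        LinearMap.sub_apply, LinearMap.sub_apply, LinearMap.add_apply, Weight.toLinear_apply]
      congr 1
      ring

/-- Apart from the line through `z`, the cyclic module lives in weights strictly below `lam`. -/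
lemma IsHighestWeightVector.exists_eq_smul_add {lam : Dual ℂ H} {z w : Z}
    (hz : IsHighestWeightVector b lam z) (hw : w ∈ LieSubmodule.lieSpan ℂ 𝔤 {z}) :
    ∃ a : ℂ, ∃ p ∈ ⨆ c : posCone b, (genWeightSpace Z (lam - c.1 : H → ℂ)).toSubmodule,
      w = a • z + p := by
  let D : LieSubmodule ℂ 𝔤 Z :=
    { Submodule.span ℂ {w | Descendant b z w} with
      lie_mem := by
        intro x w hw
        change w ∈ Submodule.span ℂ {w | Descendant b z w} at hw
        change ⁅x, w⁆ ∈ Submodule.span ℂ {w | Descendant b z w}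
        induction hw using Submodule.span_induction with
        | mem w hw => exact hz.lie_descendant_mem x hw
        | zero => rw [lie_zero]; exact Submodule.zero_mem _
        | add u v _ _ hu hv => rw [lie_add]; exact Submodule.add_mem _ hu hv
        | smul c u _ hu => rw [lie_smul]; exact Submodule.smul_mem _ c hu }
  have hD : LieSubmodule.lieSpan ℂ 𝔤 {z} ≤ D := by
    rw [LieSubmodule.lieSpan_le, Set.singleton_subset_iff]
    exact Submodule.subset_span Descendant.base
  have hwD : w ∈ Submodule.span ℂ {w | Descendant b z w} := hD hw
  have hle : Submodule.span ℂ {w | Descendant b z w} ≤ Submodule.span ℂ {z} ⊔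
      ⨆ c : posCone b, (genWeightSpace Z (lam - c.1 : H → ℂ)).toSubmodule := by
    refine Submodule.span_le.mpr fun w hw => ?_
    rcases hz.descendant_eq_or hw with rfl | ⟨c, hc, hcw⟩
    · exact Submodule.mem_sup_left (Submodule.mem_span_singleton_self w)
    · refine Submodule.mem_sup_right (Submodule.mem_iSup_of_mem ⟨c, hc⟩ ?_)
      exact weightSpace_le_genWeightSpace Z _ ((mem_weightSpace _ w).mpr hcw)
  obtain ⟨y, hy, p, hp, rfl⟩ := Submodule.mem_sup.mp (hle hwD)
  obtain ⟨a, rfl⟩ := Submodule.mem_span_singleton.mp hy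
  exact ⟨a, p, hp, rfl⟩

lemma IsHighestWeightVector.mem_genWeightSpace {lam : Dual ℂ H} {z : Z}
    (hz : IsHighestWeightVector b lam z) : z ∈ genWeightSpace Z (lam : H → ℂ) :=
  weightSpace_le_genWeightSpace Z _ ((mem_weightSpace _ z).mpr hz.weight)

open scoped ComplexOrder in
/-- The Casimir operator separates `lam` from the dominant weights below it. -/
lemma IsHighestWeightVector.sub_notMem_posCone [FiniteDimensional ℂ Z] {lam ν : Dual ℂ H}
    {z k : Z} (hz : IsHighestWeightVector b lam z) (hz₀ : z ≠ 0)
    (hk : IsHighestWeightVector b ν k) (hk₀ : k ≠ 0)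
    (hkz : k ∈ LieSubmodule.lieSpan ℂ 𝔤 {z}) {c : Dual ℂ H} (hc : c ∈ posCone b) :
    ν ≠ lam - c := by
  intro hν
  obtain ⟨n, e, e', hdual, hcas⟩ := exists_casimir H
  set s := lam ((cartanEquivDual H).symm lam) + lam ((cartanEquivDual H).symm (twoRho b)) with hs
  let D : LieSubmodule ℂ 𝔤 Z :=
    { LinearMap.ker (casimir e e' Z - s • LinearMap.id) with
      lie_mem := by
        intro x w hw
        change w ∈ LinearMap.ker (casimir e e' Z - s • LinearMap.id) at hw
        change ⁅x, w⁆ ∈ LinearMap.ker (casimir e e' Z - s • LinearMap.id)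
        rw [LinearMap.mem_ker, LinearMap.sub_apply, LinearMap.smul_apply, LinearMap.id_apply,
          sub_eq_zero] at hw ⊢
        rw [casimir_lie hdual, hw, lie_smul] }
  have hD : LieSubmodule.lieSpan ℂ 𝔤 {z} ≤ D := by
    rw [LieSubmodule.lieSpan_le, Set.singleton_subset_iff]
    change z ∈ LinearMap.ker (casimir e e' Z - s • LinearMap.id)
    rw [LinearMap.mem_ker, LinearMap.sub_apply, LinearMap.smul_apply, LinearMap.id_apply,
      sub_eq_zero, hcas b Z lam z hz]
  have hkD : k ∈ LinearMap.ker (casimir e e' Z - s • LinearMap.id) := hD hkz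
  rw [LinearMap.mem_ker, LinearMap.sub_apply, LinearMap.smul_apply, LinearMap.id_apply,
    sub_eq_zero, hcas b Z ν k hk] at hkD
  have heq := smul_left_injective ℂ hk₀ hkD
  -- With `lam = ν + c`, equality of the Casimir scalars reads `(c, lam) + (c, ν) + (c, 2ρ) = 0`.
  -- The first two terms are nonnegative by dominance and the third is positive.
  have h₁ := apply_nonneg_of_mem_posCone (hz.exists_nat hz₀) hc
  have h₂ := apply_nonneg_of_mem_posCone (hk.exists_nat hk₀) hc
  have h₃ := apply_twoRho_pos hc
  have hsum := add_pos_of_nonneg_of_pos (add_nonneg h₁ h₂) h₃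
  refine hsum.ne' ?_
  have hlam : lam = ν + c := by rw [hν, sub_add_cancel]
  have hcomm := apply_cartanEquivDual_symm_comm ν c
  simp only [hs, hlam, map_add, LinearMap.add_apply] at heq ⊢
  linear_combination -heq - hcomm

/-- A nonzero submodule of a finite dimensional cyclic highest weight module contains the highest
weight vector. -/
theorem IsHighestWeightVector.mem_of_ne_bot [FiniteDimensional ℂ Z] {lam : Dual ℂ H} {z : Z}
    (hz : IsHighestWeightVector b lam z) {K : LieSubmodule ℂ 𝔤 Z}
    (hK : K ≤ LieSubmodule.lieSpan ℂ 𝔤 {z}) (hK₀ : K ≠ ⊥) : z ∈ K := by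
  have hz₀ : z ≠ 0 := by
    rintro rfl
    refine hK₀ (le_bot_iff.mp (hK.trans ?_))
    rw [LieSubmodule.lieSpan_le]
    simp
  have : Nontrivial K := (LieSubmodule.nontrivial_iff_ne_bot ℂ 𝔤 Z).mpr hK₀
  obtain ⟨ν, ⟨k, hkK⟩, hk₀', hk'⟩ := exists_isHighestWeightVector b K
  have hk₀ : k ≠ 0 := fun h => hk₀' (Subtype.ext h)
  have hk : IsHighestWeightVector b ν k :=
    ⟨fun β x hx => congrArg Subtype.val (hk'.pos β x hx),
      fun h => congrArg Subtype.val (hk'.weight h)⟩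
  have hnot := fun c (hc : c ∈ posCone b) => hz.sub_notMem_posCone hz₀ hk hk₀ (hK hkK) hc
  obtain ⟨a, p, hp, hkp⟩ := hz.exists_eq_smul_add (hK hkK)
  have hind := iSupIndep_genWeightSpace ℂ H Z
  have hzero : ∀ {χ : Dual ℂ H} {w : Z}, w ∈ genWeightSpace Z (χ : H → ℂ) →
      w ∈ ⨆ j, ⨆ (_ : j ≠ (χ : H → ℂ)), genWeightSpace Z j → w = 0 := by
    intro χ w h₁ h₂
    have := (hind (χ : H → ℂ)).le_bot ((LieSubmodule.mem_inf _ _ _).mpr ⟨h₁, h₂⟩)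
    simpa using this
  have hp' : ∀ {χ : Dual ℂ H}, (∀ c ∈ posCone b, χ ≠ lam - c) →
      p ∈ ⨆ j, ⨆ (_ : j ≠ (χ : H → ℂ)), genWeightSpace Z j := by
    intro χ hχ
    have hle : ⨆ c : posCone b, (genWeightSpace Z (lam - c.1 : H → ℂ)).toSubmodule ≤
        (⨆ j, ⨆ (_ : j ≠ (χ : H → ℂ)), genWeightSpace Z j).toSubmodule := by
      refine iSup_le fun c => ?_
      refine (LieSubmodule.toSubmodule_le_toSubmodule _ _).mpr (le_iSup₂_of_le _ (fun h => ?_) le_rfl)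
      exact hχ c.1 c.2 (DFunLike.coe_injective h.symm)
    exact hle hp
  -- If `ν = lam`, then `p` has weight `lam` but lies in the sum of the other weight spaces, so `p =
  -- 0` and `k` is a multiple of `z`. If `ν ≠ lam`, neither `a • z` nor `p` has a component of
  -- weight `ν`, so `k = 0`.
  by_cases hν : ν = lam
  · subst hν
    have hpν : p ∈ genWeightSpace Z (ν : H → ℂ) := by
      have : p = k - a • z := by rw [hkp]; abel
      rw [this]
      exact sub_mem hk.mem_genWeightSpace (Submodule.smul_mem _ a hz.mem_genWeightSpace)
    have hp₀ : p = 0 := hzero hpν (hp' hnot)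
    rw [hp₀, add_zero] at hkp
    have ha : a ≠ 0 := by
      rintro rfl
      exact hk₀ (by rw [hkp, zero_smul])
    have : z = a⁻¹ • k := by rw [hkp, smul_smul, inv_mul_cancel₀ ha, one_smul]
    rw [this]
    exact Submodule.smul_mem _ _ hkK
  · refine absurd (hzero hk.mem_genWeightSpace ?_) hk₀
    rw [hkp]
    refine add_mem (Submodule.smul_mem _ a ?_) (hp' hnot)
    have hle : genWeightSpace Z (lam : H → ℂ) ≤
        ⨆ j, ⨆ (_ : j ≠ (ν : H → ℂ)), genWeightSpace Z j :=
      le_iSup₂_of_le _ (fun h => hν (DFunLike.coe_injective h.symm)) le_rfl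
    exact hle hz.mem_genWeightSpace

end Irreducible

end EssentialMonoid

namespace EssentialMonoid

open LieModule Module
open scoped TensorProduct

/-! ### Representations of the enveloping algebra -/

section Enveloping

attribute [local instance] LieRing.ofAssociativeRing

/-- By the universal property, the map `U(L) → A` extending `ι`, followed by the inclusion, is the
identity. -/
lemma adjoin_range_ι (L : Type*) [LieRing L] [LieAlgebra ℂ L] :
    Algebra.adjoin ℂ (Set.range (UniversalEnvelopingAlgebra.ι ℂ (L := L))) = ⊤ := by
  set A := Algebra.adjoin ℂ (Set.range (UniversalEnvelopingAlgebra.ι ℂ (L := L))) with hA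
  let g : L →ₗ⁅ℂ⁆ A :=
    { toFun := fun x => ⟨UniversalEnvelopingAlgebra.ι ℂ x, Algebra.subset_adjoin ⟨x, rfl⟩⟩
      map_add' := fun x y => Subtype.ext (map_add _ x y)
      map_smul' := fun c x => Subtype.ext (map_smul _ c x)
      map_lie' := fun {x y} => Subtype.ext (LieHom.map_lie _ x y) }
  have hg : A.val.comp (UniversalEnvelopingAlgebra.lift ℂ g) = AlgHom.id ℂ _ := by
    refine UniversalEnvelopingAlgebra.hom_ext ℂ (LieHom.ext fun x => ?_)
    change ((UniversalEnvelopingAlgebra.lift ℂ g (UniversalEnvelopingAlgebra.ι ℂ x) : A) :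
      UniversalEnvelopingAlgebra ℂ L) = UniversalEnvelopingAlgebra.ι ℂ x
    rw [UniversalEnvelopingAlgebra.lift_ι_apply]
    rfl
  refine Algebra.eq_top_iff.mpr fun u => ?_
  have hu := AlgHom.congr_fun hg u
  rw [AlgHom.comp_apply, AlgHom.id_apply] at hu
  rw [← hu]
  exact Subtype.property _

variable {𝔤 : Type*} [LieRing 𝔤] [LieAlgebra ℂ 𝔤] [FiniteDimensional ℂ 𝔤] [IsKilling ℂ 𝔤]
  {H : LieSubalgebra ℂ 𝔤} [H.IsCartanSubalgebra]

/-- The action of `U(𝔫⁻)` on a `𝔤`-module. -/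
def actU (b : (rootSystem H).Base) (Z : Type*) [AddCommGroup Z] [Module ℂ Z] [LieRingModule 𝔤 Z]
    [LieModule ℂ 𝔤 Z] : Un b →ₐ[ℂ] Module.End ℂ Z :=
  UniversalEnvelopingAlgebra.lift ℂ ((toEnd ℂ 𝔤 Z).comp (nMinus b).incl)

variable {b : (rootSystem H).Base}

lemma actU_ι {Z : Type*} [AddCommGroup Z] [Module ℂ Z] [LieRingModule 𝔤 Z] [LieModule ℂ 𝔤 Z]
    (y : nMinus b) (w : Z) : actU b Z (UniversalEnvelopingAlgebra.ι ℂ y) w = ⁅(y : 𝔤), w⁆ := by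
  rw [actU, UniversalEnvelopingAlgebra.lift_ι_apply]
  rfl

lemma Irrep.orbitMap_apply {r : ℕ} {lam : dominantWeights b r} (M : Irrep b r lam) (u : Un b) :
    M.orbitMap u = actU b M.V u M.vec := rfl

/-- A property of elements of `U(𝔫⁻)` follows from the case of `𝔫⁻`. -/
lemma Un_induction {p : Un b → Prop} (hι : ∀ y : nMinus b, p (UniversalEnvelopingAlgebra.ι ℂ y))
    (halg : ∀ c : ℂ, p (algebraMap ℂ _ c)) (hadd : ∀ u v, p u → p v → p (u + v))
    (hmul : ∀ u v, p u → p v → p (u * v)) (u : Un b) : p u := by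
  have hu : u ∈ Algebra.adjoin ℂ (Set.range (UniversalEnvelopingAlgebra.ι ℂ (L := nMinus b))) :=
    adjoin_range_ι (nMinus b) ▸ Algebra.mem_top
  induction hu using Algebra.adjoin_induction with
  | mem _ h => obtain ⟨y, rfl⟩ := h; exact hι y
  | algebraMap c => exact halg c
  | add u v _ _ hu hv => exact hadd u v hu hv
  | mul u v _ _ hu hv => exact hmul u v hu hv

lemma map_actU {Z X : Type*} [AddCommGroup Z] [Module ℂ Z] [LieRingModule 𝔤 Z] [LieModule ℂ 𝔤 Z]
    [AddCommGroup X] [Module ℂ X] [LieRingModule 𝔤 X] [LieModule ℂ 𝔤 X] (g : Z →ₗ⁅ℂ,𝔤⁆ X)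
    (u : Un b) (w : Z) : g (actU b Z u w) = actU b X u (g w) := by
  induction u using Un_induction generalizing w with
  | hι y => rw [actU_ι, actU_ι, LieModuleHom.map_lie]
  | halg c => simp [Module.algebraMap_end_apply]
  | hadd u v hu hv => simp [hu, hv]
  | hmul u v hu hv => simp [hu, hv]

lemma actU_mem {Z : Type*} [AddCommGroup Z] [Module ℂ Z] [LieRingModule 𝔤 Z] [LieModule ℂ 𝔤 Z]
    (D : LieSubmodule ℂ 𝔤 Z) (u : Un b) {w : Z} (hw : w ∈ D) : actU b Z u w ∈ D := by
  have h := map_actU (b := b) D.incl u ⟨w, hw⟩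
  rw [LieSubmodule.incl_apply, LieSubmodule.incl_apply] at h
  rw [← h]
  exact Subtype.property _

/-- Both actions are algebra homomorphisms in `u`, and on `𝔫⁻` they agree by the Leibniz rule. This
ties the annihilator of `v ⊗ w` to the kernel condition of `add_essential`. -/
lemma actU_tmul {V W : Type*} [AddCommGroup V] [Module ℂ V] [LieRingModule 𝔤 V]
    [LieModule ℂ 𝔤 V] [AddCommGroup W] [Module ℂ W] [LieRingModule 𝔤 W] [LieModule ℂ 𝔤 W]
    (u : Un b) (v : V) (w : W) :
    actU b (V ⊗[ℂ] W) u (v ⊗ₜ w) =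
      TensorProduct.map (LinearMap.applyₗ v ∘ₗ (actU b V).toLinearMap)
        (LinearMap.applyₗ w ∘ₗ (actU b W).toLinearMap) (comul (nMinus b) u) := by
  let Θ : Un b →ₐ[ℂ] Module.End ℂ (V ⊗[ℂ] W) :=
    (Module.endTensorEndAlgHom (R := ℂ) (S := ℂ) (A := ℂ) (M := V) (N := W)).comp
      ((Algebra.TensorProduct.map (actU b V) (actU b W)).comp (comul (nMinus b)))
  have hΘ : actU b (V ⊗[ℂ] W) = Θ := by
    refine UniversalEnvelopingAlgebra.hom_ext ℂ (LieHom.ext fun y => ?_)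
    change actU b (V ⊗[ℂ] W) (UniversalEnvelopingAlgebra.ι ℂ y) =
      Θ (UniversalEnvelopingAlgebra.ι ℂ y)
    refine TensorProduct.ext' fun v w => ?_
    simp only [Θ, AlgHom.comp_apply, comul_ι, map_add, Algebra.TensorProduct.map_tmul, map_one,
      LinearMap.add_apply, Module.endTensorEndAlgHom_apply]
    simp [actU_ι, TensorProduct.AlgebraTensorModule.map_tmul, -UniversalEnvelopingAlgebra.ι_apply]
  have heval : ∀ s : Un b ⊗[ℂ] Un b,
      Module.endTensorEndAlgHom (R := ℂ) (S := ℂ) (A := ℂ) (M := V) (N := W)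
        (Algebra.TensorProduct.map (actU b V) (actU b W) s) (v ⊗ₜ w) =
      TensorProduct.map (LinearMap.applyₗ v ∘ₗ (actU b V).toLinearMap)
        (LinearMap.applyₗ w ∘ₗ (actU b W).toLinearMap) s := by
    intro s
    induction s with
    | zero => simp
    | tmul u u' =>
      rw [Algebra.TensorProduct.map_tmul, Module.endTensorEndAlgHom_apply]
      simp [TensorProduct.AlgebraTensorModule.map_tmul]
    | add s t hs ht => rw [map_add, map_add, map_add, LinearMap.add_apply, hs, ht]
  rw [hΘ]
  exact heval _

end Enveloping

variable {𝔤 : Type*} [LieRing 𝔤] [LieAlgebra ℂ 𝔤] [FiniteDimensional ℂ 𝔤] [IsKilling ℂ 𝔤]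
  {H : LieSubalgebra ℂ 𝔤} [H.IsCartanSubalgebra] {b : (rootSystem H).Base}

/-! ### Comparison of highest weight vectors of the same weight -/

section Comparison

variable {X Y : Type*} [AddCommGroup X] [Module ℂ X] [LieRingModule 𝔤 X] [LieModule ℂ 𝔤 X]
  [AddCommGroup Y] [Module ℂ Y] [LieRingModule 𝔤 Y] [LieModule ℂ 𝔤 Y]

/-- The direct sum of two Lie modules. -/
instance prodLieRingModule : LieRingModule 𝔤 (X × Y) where
  bracket a p := (⁅a, p.1⁆, ⁅a, p.2⁆)
  add_lie _ _ _ := Prod.ext (add_lie _ _ _) (add_lie _ _ _)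
  lie_add _ _ _ := Prod.ext (lie_add _ _ _) (lie_add _ _ _)
  leibniz_lie _ _ _ := Prod.ext (leibniz_lie _ _ _) (leibniz_lie _ _ _)

instance prodLieModule : LieModule ℂ 𝔤 (X × Y) where
  smul_lie _ _ _ := Prod.ext (smul_lie _ _ _) (smul_lie _ _ _)
  lie_smul _ _ _ := Prod.ext (lie_smul _ _ _) (lie_smul _ _ _)

variable (𝔤 X Y) in
/-- The first projection of a direct sum of Lie modules. -/
def fstHom : X × Y →ₗ⁅ℂ,𝔤⁆ X := { LinearMap.fst ℂ X Y with map_lie' := rfl }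

variable (𝔤 X Y) in
/-- The second projection of a direct sum of Lie modules. -/
def sndHom : X × Y →ₗ⁅ℂ,𝔤⁆ Y := { LinearMap.snd ℂ X Y with map_lie' := rfl }

lemma IsHighestWeightVector.prod {lam : Dual ℂ H} {x : X} {y : Y}
    (hx : IsHighestWeightVector b lam x) (hy : IsHighestWeightVector b lam y) :
    IsHighestWeightVector b lam (x, y) where
  pos β a ha := Prod.ext (hx.pos β a ha) (hy.pos β a ha)
  weight h := Prod.ext (hx.weight h) (hy.weight h)

lemma IsHighestWeightVector.tmul {lam mu : Dual ℂ H} {x : X} {y : Y}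
    (hx : IsHighestWeightVector b lam x) (hy : IsHighestWeightVector b mu y) :
    IsHighestWeightVector b (lam + mu) (x ⊗ₜ[ℂ] y) where
  pos β a ha := by
    rw [TensorProduct.LieModule.lie_tmul_right, hx.pos β a ha, hy.pos β a ha,
      TensorProduct.zero_tmul, TensorProduct.tmul_zero, add_zero]
  weight h := by
    rw [TensorProduct.LieModule.lie_tmul_right, hx.weight, hy.weight, TensorProduct.tmul_smul,
      ← TensorProduct.smul_tmul', ← add_smul, LinearMap.add_apply]

/-- The annihilator in `U(𝔫⁻)` of a nonzero highest weight vector of a finite dimensional module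
depends only on the weight. -/
theorem IsHighestWeightVector.actU_eq_zero [FiniteDimensional ℂ X] [FiniteDimensional ℂ Y]
    {lam : Dual ℂ H} {x : X} {y : Y} (hx : IsHighestWeightVector b lam x) (hx₀ : x ≠ 0)
    (hy : IsHighestWeightVector b lam y) {u : Un b} (hu : actU b X u x = 0) :
    actU b Y u y = 0 := by
  set D := LieSubmodule.lieSpan ℂ 𝔤 {((x, y) : X × Y)} with hD
  have hmem : actU b (X × Y) u (x, y) ∈ D ⊓ (fstHom 𝔤 X Y).ker := by
    refine (LieSubmodule.mem_inf _ _ _).mpr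
      ⟨actU_mem D u (LieSubmodule.subset_lieSpan (Set.mem_singleton _)), ?_⟩
    rw [LieModuleHom.mem_ker, map_actU]
    exact hu
  -- The first projection is injective on `D`: a nonzero kernel would contain the generator `(x,
  -- y)`, although `x ≠ 0`. So `u (x, y)`, whose first component is zero, vanishes entirely.
  have hbot : D ⊓ (fstHom 𝔤 X Y).ker = ⊥ := by
    by_contra hne
    have hz := (hx.prod hy).mem_of_ne_bot (K := D ⊓ (fstHom 𝔤 X Y).ker) inf_le_left hne
    exact hx₀ (LieModuleHom.mem_ker.mp ((LieSubmodule.mem_inf _ _ _).mp hz).2)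
  rw [hbot, LieSubmodule.mem_bot] at hmem
  have h := map_actU (b := b) (sndHom 𝔤 X Y) u (x, y)
  rw [hmem, map_zero] at h
  exact h.symm

end Comparison

/-! ### Essential pairs -/

section Essential

variable {r : ℕ}

attribute [local instance] Irrep.finiteDimensional

lemma Irrep.isHighestWeightVector {lam : dominantWeights b r} (M : Irrep b r lam) :
    IsHighestWeightVector b lam.1.1 M.vec :=
  ⟨M.vec_pos, M.vec_weight⟩

theorem Irrep.IsEssential.add {N : ℕ} {x : Fin N → nMinus b}
    {lt : (Fin N → ℕ) → (Fin N → ℕ) → Prop} (hlt : IsMonomialOrder lt)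
    {lam mu : dominantWeights b r} {V : Irrep b r lam} {W : Irrep b r mu}
    (X : Irrep b r (lam + mu)) {m m' : Fin N → ℕ} (hV : V.IsEssential x lt m)
    (hW : W.IsEssential x lt m') : X.IsEssential x lt (m + m') := by
  rw [Irrep.isEssential_iff] at hV hW ⊢
  refine add_essential hlt (fun u hu => ?_) hV hW
  rw [Irrep.orbitMap_apply] at hu
  have hy : IsHighestWeightVector b (lam + mu).1.1 (V.vec ⊗ₜ[ℂ] W.vec) :=
    V.isHighestWeightVector.tmul W.isHighestWeightVector
  have h := X.isHighestWeightVector.actU_eq_zero X.vec_ne_zero hy hu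
  rw [actU_tmul] at h
  exact h

lemma tmul_ne_zero {V W : Type*} [AddCommGroup V] [Module ℂ V] [AddCommGroup W] [Module ℂ W]
    {v : V} {w : W} (hv : v ≠ 0) (hw : w ≠ 0) : v ⊗ₜ[ℂ] w ≠ 0 := by
  intro h
  obtain ⟨φ, hφ⟩ := not_forall.mp (mt (Module.forall_dual_apply_eq_zero_iff ℂ v).mp hv)
  obtain ⟨ψ, hψ⟩ := not_forall.mp (mt (Module.forall_dual_apply_eq_zero_iff ℂ w).mp hw)
  have h' := congrArg (LinearMap.mul' ℂ ℂ ∘ₗ TensorProduct.map φ ψ) h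
  rw [LinearMap.comp_apply, TensorProduct.map_tmul, LinearMap.mul'_apply, map_zero] at h'
  exact mul_ne_zero hφ hψ h'

/-- The character of `(ℂ^*)^r` given by an element of `ℤ^r`. -/
def torusCharacter (n : Fin r → ℤ) : (Fin r → ℂˣ) →* ℂ where
  toFun t := ∏ i, (t i : ℂ) ^ n i
  map_one' := by simp
  map_mul' s t := by
    simp only [Pi.mul_apply, Units.val_mul, mul_zpow, Finset.prod_mul_distrib]

/-- The irreducible representation generated by a highest weight vector. -/
def Irrep.ofHighestWeightVector {lam : dominantWeights b r} {Z : Type*} [AddCommGroup Z]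
    [Module ℂ Z] [LieRingModule 𝔤 Z] [LieModule ℂ 𝔤 Z] [FiniteDimensional ℂ Z] {z : Z}
    (hz : IsHighestWeightVector b lam.1.1 z) (hz₀ : z ≠ 0) : Irrep b r lam where
  V := LieSubmodule.lieSpan ℂ 𝔤 {z}
  finiteDimensional := inferInstanceAs
    (FiniteDimensional ℂ (LieSubmodule.lieSpan ℂ 𝔤 {z}).toSubmodule)
  -- The torus acts by scalars, so irreducibility must already hold over `𝔤`.
  torus := (algebraMap ℂ (Module.End ℂ (LieSubmodule.lieSpan ℂ 𝔤 {z}))).toMonoidHom.comp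
    (torusCharacter lam.1.2)
  torus_lie t x w := (lie_smul (torusCharacter lam.1.2 t) x w).symm
  irreducible W _ := by
    refine or_iff_not_imp_left.mpr fun hW => ?_
    have hW' : W.map (LieSubmodule.lieSpan ℂ 𝔤 {z}).incl ≠ ⊥ := by
      intro h
      refine hW ((LieSubmodule.eq_bot_iff _).mpr fun w hw => Subtype.ext ?_)
      have := LieSubmodule.mem_map_of_mem (f := (LieSubmodule.lieSpan ℂ 𝔤 {z}).incl) hw
      rw [h] at this
      simpa using this
    have hzW := hz.mem_of_ne_bot (LieSubmodule.map_incl_le) hW'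
    have hle : LieSubmodule.lieSpan ℂ 𝔤 {z} ≤ W.map (LieSubmodule.lieSpan ℂ 𝔤 {z}).incl := by
      rw [LieSubmodule.lieSpan_le, Set.singleton_subset_iff]
      exact hzW
    refine eq_top_iff.mpr fun w _ => ?_
    obtain ⟨w', hw', hww'⟩ := (LieSubmodule.mem_map _).mp (hle w.2)
    have : w' = w := Subtype.ext hww'
    exact this ▸ hw'
  vec := ⟨z, LieSubmodule.subset_lieSpan (Set.mem_singleton z)⟩
  vec_ne_zero h := hz₀ (congrArg Subtype.val h)
  vec_pos β x hx := Subtype.ext (hz.pos β x hx)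
  vec_weight h := Subtype.ext (hz.weight h)
  vec_torus _ := rfl

/-- The trivial representation. -/
def Irrep.trivial (b : (rootSystem H).Base) (r : ℕ) : Irrep.{_, 0} b r 0 :=
  haveI : FiniteDimensional ℂ (TrivialLieModule ℂ 𝔤 ℂ) :=
    inferInstanceAs (FiniteDimensional ℂ ℂ)
  Irrep.ofHighestWeightVector (Z := TrivialLieModule ℂ 𝔤 ℂ)
    (z := (TrivialLieModule.equiv ℂ 𝔤 ℂ).symm 1)
    ⟨fun _ _ _ => LieModule.IsTrivial.trivial _ _, fun _ => by
      rw [LieModule.IsTrivial.trivial]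
      simp⟩
    (by simp)

/-- The Cartan component of the tensor product of two irreducible representations. -/
def Irrep.cartanComponent {lam mu : dominantWeights b r} (V : Irrep b r lam) (W : Irrep b r mu) :
    Irrep b r (lam + mu) :=
  Irrep.ofHighestWeightVector (Z := V.V ⊗[ℂ] W.V) (z := V.vec ⊗ₜ W.vec)
    (V.isHighestWeightVector.tmul W.isHighestWeightVector)
    (tmul_ne_zero V.vec_ne_zero W.vec_ne_zero)

variable {N : ℕ} {x : Fin N → nMinus b} {lt : (Fin N → ℕ) → (Fin N → ℕ) → Prop}

lemma zero_mem_es (hlt : IsMonomialOrder lt) : 0 ∈ es x lt (0 : dominantWeights b r) := by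
  refine ⟨Irrep.trivial b r, ?_⟩
  rw [Irrep.isEssential_iff, divMonomial_zero, Ult_zero hlt, Submodule.map_bot,
    Submodule.mem_bot, Irrep.orbitMap_apply, map_one]
  exact Irrep.vec_ne_zero _

/-- Membership in `es` asks that a representation exist; the Cartan component supplies it. -/
lemma add_mem_es (hlt : IsMonomialOrder lt) {lam mu : dominantWeights b r} {m m' : Fin N → ℕ}
    (hm : m ∈ es x lt lam) (hm' : m' ∈ es x lt mu) : m + m' ∈ es x lt (lam + mu) := by
  obtain ⟨V, hV⟩ := hm
  obtain ⟨W, hW⟩ := hm'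
  exact ⟨V.cartanComponent W, hV.add hlt _ hW⟩

/-- The point is that `1 ≠ 0` in `U(𝔫⁻)`, which is seen on the trivial representation. -/
lemma zero_mem_esU (hlt : IsMonomialOrder lt) : 0 ∈ esU x lt := by
  rw [mem_esU_iff, divMonomial_zero, Ult_zero hlt, Submodule.mem_bot]
  intro h
  have h' : (Irrep.trivial b 0).orbitMap 1 = (Irrep.trivial b 0).vec := by
    rw [Irrep.orbitMap_apply, map_one, Module.End.one_apply]
  rw [h, map_zero] at h'
  exact (Irrep.trivial b 0).vec_ne_zero h'.symm

end Essential

end EssentialMonoid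

end

theorem mainTheorem8 {𝔤 : Type*} [LieRing 𝔤] [LieAlgebra ℂ 𝔤] [FiniteDimensional ℂ 𝔤]
    [LieAlgebra.IsKilling ℂ 𝔤] (H : LieSubalgebra ℂ 𝔤) [H.IsCartanSubalgebra]
    (b : (LieAlgebra.IsKilling.rootSystem H).Base) (r : ℕ)
    (f : EssentialMonoid.PosRoot b → EssentialMonoid.nMinus b)
    (hf : EssentialMonoid.IsRootVectors b f)
    (S : Fin (EssentialMonoid.numPos b) → EssentialMonoid.PosRoot b)
    (hS : EssentialMonoid.IsBirational hf S)
    (lt : (Fin (EssentialMonoid.numPos b) → ℕ) → (Fin (EssentialMonoid.numPos b) → ℕ) → Prop)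
    (hlt : EssentialMonoid.IsWeightedLexOrder lt) :
    (∃ E : AddSubmonoid (Fin (EssentialMonoid.numPos b) → ℕ),
      (E : Set (Fin (EssentialMonoid.numPos b) → ℕ)) =
        EssentialMonoid.esU (fun i => f (S i)) lt) ∧
    (∀ (lam mu : EssentialMonoid.dominantWeights b r)
      (V : EssentialMonoid.Irrep b r lam) (W : EssentialMonoid.Irrep b r mu)
      (X : EssentialMonoid.Irrep b r (lam + mu)) (m m' : Fin (EssentialMonoid.numPos b) → ℕ),
      V.IsEssential (fun i => f (S i)) lt m → W.IsEssential (fun i => f (S i)) lt m' →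
        X.IsEssential (fun i => f (S i)) lt (m + m')) ∧
    (∀ lam : EssentialMonoid.dominantWeights b r,
      ∃ E : AddSubmonoid (ℕ × (Fin (EssentialMonoid.numPos b) → ℕ)),
        (E : Set (ℕ × (Fin (EssentialMonoid.numPos b) → ℕ))) =
          EssentialMonoid.gammaOf (fun i => f (S i)) lt lam) ∧
    (∃ E : AddSubmonoid
        (EssentialMonoid.dominantWeights b r × (Fin (EssentialMonoid.numPos b) → ℕ)),
      (E : Set (EssentialMonoid.dominantWeights b r × (Fin (EssentialMonoid.numPos b) → ℕ))) =
        EssentialMonoid.gamma r (fun i => f (S i)) lt) := by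
  have hlt' := hlt.isMonomialOrder
  refine ⟨⟨⟨⟨_, EssentialMonoid.add_mem_esU hlt'⟩, EssentialMonoid.zero_mem_esU hlt'⟩, rfl⟩,
    fun lam mu V W X m m' hV hW => hV.add hlt' X hW, fun lam => ?_, ?_⟩
  · refine ⟨⟨⟨_, fun {p q} hp hq => ?_⟩, ?_⟩, rfl⟩
    · change p.2 + q.2 ∈ EssentialMonoid.es _ lt ((p.1 + q.1) • lam)
      rw [add_smul]
      exact EssentialMonoid.add_mem_es hlt' hp hq
    · change 0 ∈ EssentialMonoid.es _ lt (0 • lam)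
      rw [zero_smul]
      exact EssentialMonoid.zero_mem_es hlt'
  · exact ⟨⟨⟨_, EssentialMonoid.add_mem_es hlt'⟩, EssentialMonoid.zero_mem_es hlt'⟩, rfl⟩
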